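/- Let $n\ge 1$ be an integer, $\mu_1,\mu_2\in\mathbb R$, $\delta:=(\mu_1-1)^2-4\mu_2\ge 0$, and consider $$u_{tt}-\Delta u+\frac{\mu_1}{1+t}u_t+\frac{\mu_2}{(1+t)^2}u=|u|^p\ \text{ in }\mathbb R^n\times(0,T),\qquad u(x,0)=\varepsilon f(x),\quad u_t(x,0)=\varepsilon g(x). \tag{1}$$ Put $\gamma_F(p,\nu)=2-\nu(p-1)$ and $\gamma_S(p,\nu)=2+(\nu+1)p-(\nu-1)p^2$; $p_F(\nu)=1+\frac2\nu$ if $\nu>0$ and $+\infty$ if $\nu\le0$; $p_S(\nu)=\frac{\nu+1+\sqrt{\nu^2+10\nu-7}}{2(\nu-1)}$ if $\nu>1$ and $+\infty$ if $\nu\le1$; $d_*(\nu)=\frac12\bigl(-1-\nu+\sqrt{\nu^2+10\nu-7}\bigr)$ if $\nu>1$ and $0$ if $\nu\le1$; and $\operatorname{sgn}\delta=1$ if $\delta>0$, $\operatorname{sgn}0=0$. Let $$1<p<p_{\mu_1,\delta}(n):=\max\Bigl\{p_F\bigl(n+\tfrac{\mu_1-1-\sqrt\delta}{2}\bigr),\,p_S(n+\mu_1)\Bigr\}.$$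 Let $f\in H^1(\mathbb R^n)$, $g\in L^2(\mathbb R^n)$ be such that, almost everywhere, $f\ge0$ and $h:=\frac{\mu_1-1+\sqrt\delta}{2}f+g\ge0$, with $h$ not almost everywhere zero. Let $R\ge1$. An energy solution of (1) on $[0,T)$ is a function $u\in C([0,T),H^1(\mathbb R^n))\cap C^1([0,T),L^2(\mathbb R^n))\cap C((0,T),L^p_{loc}(\mathbb R^n))$ with $u(0)=\varepsilon f$, $u_t(0)=\varepsilon g$ such that for all $\phi\in C_0^\infty(\mathbb R^n\times[0,T))$ and $t\in[0,T)$ the function $s\mapsto\int_{\mathbb R^n}|u(x,s)|^p\phi(x,s)\,dx$ is integrable on $(0,t)$ and $$\begin{aligned}&\int_{\mathbb R^n}u_t(x,t)\phi(x,t)\,dx-\int_{\mathbb R^n}\varepsilon g(x)\phi(x,0)\,dx+\int_0^t\!\!\int_{\mathbb R^n}\{-u_t\phi_t+\nabla u\cdot\nabla\phi\}\,dx\,ds\\&+\int_0^t\!\!\int_{\mathbb R^n}\frac{\mu_1}{1+s}u_t\phi\,dx\,ds+\int_0^t\!\!\int_{\mathbb R^n}\frac{\mu_2}{(1+s)^2}u\phi\,dx\,ds=\int_0^t\!\!\int_{\mathbb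 R^n}|u|^p\phi\,dx\,ds.\end{aligned}$$ Let the lifespan $T_\varepsilon\in[0,\infty]$ be the supremum of all $T>0$ for which there is an energy solution $u$ of (1) on $[0,T)$ with $\operatorname{supp}u\subset\{(x,t):|x|\le t+R\}$. Then there are constants $\varepsilon_2>0$ and $C>0$, depending only on $f,g,\mu_1,\mu_2,n,p,R$, such that for all $0<\varepsilon\le\varepsilon_2$: * if $\sqrt\delta\le n-2$, then $T_\varepsilon\le C\,\varepsilon^{-2p(p-1)/\gamma_S(p,n+\mu_1)}$; * if $n-2<\sqrt\delta<n-d_*(n+\mu_1)$, then $T_\varepsilon\le C\,\phi(\varepsilon)$ when $1<p\le\frac{2}{n-\sqrt\delta}$, and $T_\varepsilon\le C\,\varepsilon^{-2p(p-1)/\gamma_S(p,n+\mu_1)}$ when $\frac2{n-\sqrt\delta}<p<p_{\mu_1,\delta}(n)$; * if $\sqrt\delta\ge n-d_*(n+\mu_1)$, then $T_\varepsilon\le C\,\phi(\varepsilon)$. Here, in each case in which it occurs, $\phi=\phi(\varepsilon)$ is, for every $\varepsilon>0$, the unique positive solution of $$\varepsilon\,\phi^{\frac{\gamma_F(p,\,n+(\mu_1-1-\sqrt\delta)/2)}{p-1}}\,\bigl[\ln(1+\phi)\bigr]^{1-\operatorname{sgn}\delta}=1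 .$$ If in particular $\delta>0$, then in these cases $$\phi(\varepsilon)=\varepsilon^{-(p-1)/\gamma_F(p,\,n+(\mu_1-1-\sqrt\delta)/2)}=\varepsilon^{-\left[2/(p-1)-n-(\mu_1-1-\sqrt\delta)/2\right]^{-1}}.$$ -/

import Mathlib

open MeasureTheory Set Filter Topology
open scoped ENNReal ContDiff

noncomputable section

namespace ScaleInvariantWave

/-- The Euclidean space `ℝⁿ`. -/
abbrev Space (n : ℕ) : Type := EuclideanSpace ℝ (Fin n)

/-! ### Exponents -/

/-- The Fujita exponent `p_F(ν)`, equal to `+∞` for `ν ≤ 0`. -/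
def fujitaExponent (ν : ℝ) : EReal :=
  if 0 < ν then ((1 + 2 / ν : ℝ) : EReal) else ⊤

/-- The Strauss exponent `p_S(ν)`, equal to `+∞` for `ν ≤ 1`. -/
def straussExponent (ν : ℝ) : EReal :=
  if 1 < ν then
    (((ν + 1 + Real.sqrt (ν ^ 2 + 10 * ν - 7)) / (2 * (ν - 1)) : ℝ) : EReal)
  else ⊤

/-- `γ_F(p, ν) = 2 - ν (p - 1)`. -/
def gammaF (p ν : ℝ) : ℝ := 2 - ν * (p - 1)

/-- `γ_S(p, ν) = 2 + (ν + 1) p - (ν - 1) p²`. -/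
def gammaS (p ν : ℝ) : ℝ := 2 + (ν + 1) * p - (ν - 1) * p ^ 2

/-- The threshold `d_*(ν)`. -/
def dStar (ν : ℝ) : ℝ :=
  if 1 < ν then (-1 - ν + Real.sqrt (ν ^ 2 + 10 * ν - 7)) / 2 else 0

/-- `δ = (μ₁ - 1)² - 4 μ₂`. -/
def discr (μ₁ μ₂ : ℝ) : ℝ := (μ₁ - 1) ^ 2 - 4 * μ₂

/-- The shifted dimension `n + (μ₁ - 1 - √δ) / 2`. -/
def heatDim (n : ℕ) (μ₁ δ : ℝ) : ℝ := n + (μ₁ - 1 - Real.sqrt δ) / 2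

/-- `p_{μ₁,δ}(n) = max {p_F(n + (μ₁ - 1 - √δ)/2), p_S(n + μ₁)}`. -/
def blowupExponent (n : ℕ) (μ₁ δ : ℝ) : EReal :=
  max (fujitaExponent (heatDim n μ₁ δ)) (straussExponent (n + μ₁))

/-- `y` is a (positive) solution of
`ε y ^ (γ_F(p, n + (μ₁ - 1 - √δ)/2) / (p - 1)) (ln (1 + y)) ^ (1 - sgn δ) = 1`. -/
def IsHeatScale (n : ℕ) (μ₁ δ p ε y : ℝ) : Prop :=
  0 < y ∧
    ε * y ^ (gammaF p (heatDim n μ₁ δ) / (p - 1)) * Real.log (1 + y) ^ (1 - Real.sign δ) = 1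

/-! ### Function spaces -/

/-- `G` is the weak gradient of `w` on `ℝⁿ` (tested in every direction `e`). -/
def IsWeakGradient {n : ℕ} (w : Space n → ℝ) (G : Space n → Space n) : Prop :=
  ∀ ψ : Space n → ℝ, ContDiff ℝ ∞ ψ → HasCompactSupport ψ → ∀ e : Space n,
    ∫ x, w x * fderiv ℝ ψ x e = - ∫ x, inner ℝ (G x) e * ψ x

/-- `w ∈ H¹(ℝⁿ)`. -/
def MemH1 {n : ℕ} (w : Space n → ℝ) : Prop :=
  MemLp w 2 ∧ ∃ G : Space n → Space n, MemLp G 2 ∧ IsWeakGradient w G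

/-- `φ ∈ C_0^∞(ℝⁿ × [0, T))`: the restriction to nonnegative times of a smooth function on
`ℝⁿ × ℝ` whose support is compact and lies in `{t < T}`. -/
def IsTestFunction {n : ℕ} (T : ℝ) (φ : Space n × ℝ → ℝ) : Prop :=
  ContDiff ℝ ∞ φ ∧ HasCompactSupport φ ∧ ∀ z ∈ tsupport φ, z.2 < T

/-- `u ∈ C((0, T), L^p_loc(ℝⁿ))`. -/
def ContinuousLpLoc {n : ℕ} (p T : ℝ) (u : ℝ → Space n → ℝ) : Prop :=
  ∀ K : Set (Space n), IsCompact K → ∀ t ∈ Ioo 0 T,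
    MemLp (u t) (ENNReal.ofReal p) (volume.restrict K) ∧
      Tendsto (fun s => eLpNorm (u s - u t) (ENNReal.ofReal p) (volume.restrict K)) (𝓝 t) (𝓝 0)

/-! ### Energy solutions and lifespan -/

/-- `u` is an energy solution over `[0, T)` of
`u_tt - Δu + μ₁/(1+t) u_t + μ₂/(1+t)² u = |u|^p`, `u(0) = ε f`, `u_t(0) = ε g`.

The curves `v` and `G` are `u_t` and `∇u`: continuity of `u` and `G` in `L²` says that
`u ∈ C([0, T), H¹)`, and the conditions on `v` say that `u ∈ C¹([0, T), L²)`.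
The weak equation presupposes that its right-hand side exists; the only point at which this does
not follow from the regularity of `u` is the integrability in time near `0`, which is required
explicitly. -/
def IsEnergySolution (n : ℕ) (μ₁ μ₂ p ε : ℝ) (f g : Space n → ℝ) (T : ℝ)
    (u : ℝ → Lp ℝ 2 (volume : Measure (Space n))) : Prop :=
  ∃ (v : ℝ → Lp ℝ 2 (volume : Measure (Space n)))
    (G : ℝ → Lp (Space n) 2 (volume : Measure (Space n))),
    ContinuousOn u (Ico 0 T) ∧
    ContinuousOn G (Ico 0 T) ∧
    (∀ t ∈ Ico 0 T, IsWeakGradient (u t) (G t)) ∧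
    (∀ t ∈ Ico 0 T, HasDerivWithinAt u (v t) (Ico 0 T) t) ∧
    ContinuousOn v (Ico 0 T) ∧
    ContinuousLpLoc p T (fun t => u t) ∧
    (u 0 =ᵐ[volume] fun x => ε * f x) ∧
    (v 0 =ᵐ[volume] fun x => ε * g x) ∧
    ∀ φ : Space n × ℝ → ℝ, IsTestFunction T φ → ∀ t ∈ Ico 0 T,
      IntervalIntegrable (fun s => ∫ x, |u s x| ^ p * φ (x, s)) volume 0 t ∧
      (∫ x, v t x * φ (x, t)) - (∫ x, ε * g x * φ (x, 0))
        + (∫ s in (0 : ℝ)..t, ∫ x, (- (v s x * deriv (fun r => φ (x, r)) s)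
            + inner ℝ (G s x) (gradient (fun y => φ (y, s)) x)))
        + (∫ s in (0 : ℝ)..t, ∫ x, μ₁ / (1 + s) * v s x * φ (x, s))
        + (∫ s in (0 : ℝ)..t, ∫ x, μ₂ / (1 + s) ^ 2 * u s x * φ (x, s))
      = ∫ s in (0 : ℝ)..t, ∫ x, |u s x| ^ p * φ (x, s)

/-- `supp u ⊆ {(x, t) : |x| ≤ t + R}` for a curve `u` over `[0, T)`. -/
def SupportedInCone {n : ℕ} (R T : ℝ) (u : ℝ → Lp ℝ 2 (volume : Measure (Space n))) : Prop :=
  ∀ t ∈ Ico 0 T, ∀ᵐ x, t + R < ‖x‖ → u t x = 0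

/-- The lifespan `T_ε`: the supremum of all `T > 0` for which there is an energy solution over
`[0, T)` with data `ε f`, `ε g` and support in `{|x| ≤ t + R}`. -/
def lifespan (n : ℕ) (μ₁ μ₂ p R : ℝ) (f g : Space n → ℝ) (ε : ℝ) : ℝ≥0∞ :=
  sSup {τ : ℝ≥0∞ | ∃ T : ℝ, 0 < T ∧ τ = ENNReal.ofReal T ∧
    ∃ u : ℝ → Lp ℝ 2 (volume : Measure (Space n)),
      IsEnergySolution n μ₁ μ₂ p ε f g T u ∧ SupportedInCone R T u}

end ScaleInvariantWave

end

open ScaleInvariantWave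

namespace ScaleInvariantWave

/-! ### Ordinary differential inequalities -/

/-! Testing the equation with a plane wave e^{x·ξ}, cut off outside the support of u, gives a moment
A with A'' + μ₁/(1+t) A' + μ₂/(1+t)² A = |ξ|² A + N and N ≥ 0. Since δ ≥ 0, the left side factors
over the reals with a, κ = (μ₁ - 1 ± √δ)/2: the quantity D = (1+t)^κ ((1+t) A' + a A) satisfies D' =
(1+t)^(κ+1) (|ξ|² A + N). The sign conditions on f and h give A(0) ≥ 0 and D(0) ≥ εH with H > 0, and
both bounds persist.

For ξ = 0 put τ = log(1+t) and F = (1+t)^κ A. Then F' = D - √δ F, and Hölder on the ball of radius t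
+ R gives D' ≥ c e^{γτ} F^p with γ = γ_F(p, n+κ). The natural scale of this system is e^{-γτ/(p-1)}:
once F and D exceed a large multiple of it, the solution cannot last one more unit of τ
(`LogSystem.le_of_large`). Any lower bound that reaches this scale at τ₀ therefore bounds T by a
multiple of e^{τ₀}. Two are available.

Heat-like bound (`LogSystem.le_of_heat`): D ≥ εH forces F ≳ ε, and F ≳ ετ when √δ = 0. Equating with
the natural scale gives φ(ε), and the undamped case accounts for its logarithm.

Wave-like bound (`LogSystem.le_of_wave`): for |ξ| = 1 the moments grow like ε e^t (1+t)^(-μ₁/2)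
(`MomentSystem.exp_growth`). Averaging over directions replaces the plane wave by a weight of size
e^{|x|} (1+|x|)^(-(n-1)/2) (`waveAverage_le`). In Hölder's inequality the exponentials cancel,
leaving D' ≥ c ε^p e^{βτ} with β + γ_F/(p-1) = γ_S/(2(p-1)). This yields the power ε^(-2p(p-1)/γ_S).

The identity 2p γ_F - γ_S = (p-1)(2 - p(n - √δ)) governs the case distinction: p below the maximum
of the two critical exponents makes γ_F or γ_S positive, and the sign of 2 - p(n - √δ) transfers
positivity to the exponent that is needed. -/

theorem le_of_hasDerivAt_nonneg {f f' : ℝ → ℝ} {a b : ℝ} (hab : a ≤ b)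
    (hc : ContinuousOn f (Icc a b)) (hd : ∀ x ∈ Ioo a b, HasDerivAt f (f' x) x)
    (h0 : ∀ x ∈ Ioo a b, 0 ≤ f' x) : f a ≤ f b := by
  have hm : MonotoneOn f (Icc a b) := by
    apply monotoneOn_of_deriv_nonneg (convex_Icc a b) hc
    · intro x hx
      rw [interior_Icc] at hx
      exact (hd x hx).differentiableAt.differentiableWithinAt
    · intro x hx
      rw [interior_Icc] at hx
      rw [(hd x hx).deriv]
      exact h0 x hx
  exact hm (left_mem_Icc.2 hab) (right_mem_Icc.2 hab) hab

/-- A linear lower bound for the increment of a function whose derivative is at least `m`. -/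
theorem add_mul_le_of_le_hasDerivAt {f f' : ℝ → ℝ} {a b m : ℝ} (hab : a ≤ b)
    (hc : ContinuousOn f (Icc a b)) (hd : ∀ x ∈ Ioo a b, HasDerivAt f (f' x) x)
    (h0 : ∀ x ∈ Ioo a b, m ≤ f' x) : f a + m * (b - a) ≤ f b := by
  have := le_of_hasDerivAt_nonneg (f := fun x => f x - m * x) (f' := fun x => f' x - m) hab
    (hc.sub (by fun_prop))
    (fun x hx => (hd x hx).sub (by simpa using (hasDerivAt_id x).const_mul m))
    (fun x hx => sub_nonneg.2 (h0 x hx))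
  linarith

/-- Continuous induction for positivity. -/
theorem pos_of_forall_lt_pos {y : ℝ → ℝ} {a b : ℝ} (hc : ContinuousOn y (Icc a b)) (ha : 0 < y a)
    (step : ∀ s ∈ Ioc a b, (∀ r ∈ Ico a s, 0 < y r) → 0 < y s) :
    ∀ s ∈ Icc a b, 0 < y s := by
  by_contra! hne
  obtain ⟨s, hs, hys⟩ := hne
  have hcl : IsCompact (Icc a b ∩ y ⁻¹' Iic 0) := by
    have := hc.preimage_isClosed_of_isClosed isClosed_Icc (isClosed_Iic (a := (0 : ℝ)))
    exact isCompact_Icc.of_isClosed_subset this inter_subset_left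
  obtain ⟨t, ⟨ht, hyt⟩, hmin⟩ := hcl.exists_isLeast ⟨s, hs, hys⟩
  have hat : a < t := by
    rcases ht.1.eq_or_lt with h | h
    · subst h
      exact absurd hyt (not_le.2 ha)
    · exact h
  refine absurd (step t ⟨hat, ht.2⟩ fun r hr => ?_) (not_lt.2 hyt)
  by_contra hr0
  exact absurd (hmin ⟨⟨hr.1, hr.2.le.trans ht.2⟩, not_lt.1 hr0⟩) (not_le.2 hr.2)

/-- Blow-up before time `1` for `F' = D - b F`, `D' ≥ c |F| ^ p` with large data, by comparison with
`Y (1 - τ) ^ (-2 / (p - 1))`. -/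
theorem blowup_unit_time {p b c Y τ₀ : ℝ} (hp : 1 < p) (hb : 0 ≤ b) (hc : 0 ≤ c) (hY : 0 < Y)
    (hcY : 2 / (p - 1) * (2 / (p - 1) + 1) + b * (2 / (p - 1)) ≤ c * Y ^ (p - 1))
    {F D D' : ℝ → ℝ}
    (hF : ∀ τ ∈ Icc τ₀ (τ₀ + 1), HasDerivAt F (D τ - b * F τ) τ)
    (hD : ∀ τ ∈ Icc τ₀ (τ₀ + 1), HasDerivAt D (D' τ) τ)
    (hD' : ∀ τ ∈ Icc τ₀ (τ₀ + 1), c * |F τ| ^ p ≤ D' τ)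
    (hF0 : Y < F τ₀) (hD0 : Y * (2 / (p - 1) + b) < D τ₀) : False := by
  set q := 2 / (p - 1) with hq
  have hp1 : 0 < p - 1 := by linarith
  have hq0 : 0 < q := by positivity
  -- The choice q = 2/(p-1) balances the barrier: the p-th power of θ^(-q) has the order of its
  -- second derivative.
  have hqp : -q * p = -q - 1 - 1 := by
    rw [hq]; field_simp; ring
  have hθd (e τ : ℝ) (hτ : τ < τ₀ + 1) :
      HasDerivAt (fun τ => (1 - (τ - τ₀)) ^ e) (-e * (1 - (τ - τ₀)) ^ (e - 1)) τ := by
    have h1 : HasDerivAt (fun τ => 1 - (τ - τ₀)) (-1) τ := by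
      simpa using ((hasDerivAt_id τ).sub_const τ₀).const_sub 1
    convert h1.rpow_const (p := e) (Or.inl (by linarith)) using 1
    ring
  set Fs : ℝ → ℝ := fun τ => Y * (1 - (τ - τ₀)) ^ (-q) with hFs
  set Ds : ℝ → ℝ := fun τ => Y * (q * (1 - (τ - τ₀)) ^ (-q - 1) + b * (1 - (τ - τ₀)) ^ (-q))
    with hDs
  have hFsd (τ : ℝ) (hτ : τ < τ₀ + 1) : HasDerivAt Fs (Ds τ - b * Fs τ) τ := by
    refine ((hθd (-q) τ hτ).const_mul Y).congr_deriv ?_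
    simp only [hFs, hDs]; ring
  have hDsd (τ : ℝ) (hτ : τ < τ₀ + 1) : HasDerivAt Ds
      (Y * (q * ((q + 1) * (1 - (τ - τ₀)) ^ (-q - 1 - 1))
        + b * (q * (1 - (τ - τ₀)) ^ (-q - 1)))) τ := by
    refine ((((hθd (-q - 1) τ hτ).const_mul q).add
      ((hθd (-q) τ hτ).const_mul b)).const_mul Y).congr_deriv ?_
    ring
  -- `Ds' ≤ c Fs ^ p`
  have hDsle (τ : ℝ) (hτ : τ ∈ Ico τ₀ (τ₀ + 1)) :
      Y * (q * ((q + 1) * (1 - (τ - τ₀)) ^ (-q - 1 - 1)) + b * (q * (1 - (τ - τ₀)) ^ (-q - 1)))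
        ≤ c * Fs τ ^ p := by
    have hθ : 0 < 1 - (τ - τ₀) := by linarith [hτ.2]
    have hθ1 : 1 - (τ - τ₀) ≤ 1 := by linarith [hτ.1]
    have e1 : Fs τ ^ p = Y * Y ^ (p - 1) * (1 - (τ - τ₀)) ^ (-q - 1 - 1) := by
      simp only [hFs]
      rw [Real.mul_rpow hY.le (by positivity), ← Real.rpow_mul hθ.le, hqp]
      congr 1
      rw [← Real.rpow_one_add' hY.le (by linarith)]
      congr 1; ring
    have e2 : (1 - (τ - τ₀)) ^ (-q - 1) ≤ (1 - (τ - τ₀)) ^ (-q - 1 - 1) :=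
      Real.rpow_le_rpow_of_exponent_ge hθ hθ1 (by linarith)
    set θ2 := (1 - (τ - τ₀)) ^ (-q - 1 - 1)
    have hθ2 : 0 < θ2 := Real.rpow_pos_of_pos hθ _
    rw [e1]
    calc _ ≤ Y * (q * ((q + 1) * θ2) + b * (q * θ2)) := by gcongr
      _ = Y * θ2 * (q * (q + 1) + b * q) := by ring
      _ ≤ Y * θ2 * (c * Y ^ (p - 1)) := by gcongr
      _ = _ := by ring
  -- comparison of the first components
  have hcompF (s : ℝ) (hs : s ∈ Ico τ₀ (τ₀ + 1)) (h : ∀ r ∈ Ico τ₀ s, 0 < D r - Ds r) :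
      Fs s < F s := by
    -- The integrating factor e^{bτ} removes the damping, so that F - Fs inherits its sign from D -
    -- Ds.
    have hd (r : ℝ) (hr : r ∈ Icc τ₀ s) : HasDerivAt (fun τ => Real.exp (b * τ) * (F τ - Fs τ))
        (Real.exp (b * r) * (D r - Ds r)) r := by
      have hexp : HasDerivAt (fun τ => Real.exp (b * τ)) (Real.exp (b * r) * b) r := by
        simpa using ((hasDerivAt_id r).const_mul b).exp
      refine (hexp.mul ((hF r ⟨hr.1, by linarith [hr.2, hs.2]⟩).sub
        (hFsd r (by linarith [hr.2, hs.2])))).congr_deriv ?_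
      simp only [Pi.sub_apply]
      ring
    have := le_of_hasDerivAt_nonneg hs.1
      (fun r hr => (hd r hr).continuousAt.continuousWithinAt)
      (fun r hr => hd r (Ioo_subset_Icc_self hr))
      (fun r hr => mul_nonneg (Real.exp_pos _).le (h r ⟨hr.1.le, hr.2⟩).le)
    have h0 : 0 < Real.exp (b * τ₀) * (F τ₀ - Fs τ₀) := by
      refine mul_pos (Real.exp_pos _) ?_
      simp only [hFs, sub_self, sub_zero, Real.one_rpow]
      linarith
    have h2 := pos_of_mul_pos_right (h0.trans_le this) (Real.exp_pos _).le
    linarith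
  have hcompD (s : ℝ) (hs : s ∈ Ico τ₀ (τ₀ + 1)) : ∀ r ∈ Icc τ₀ s, 0 < D r - Ds r := by
    have hd (r : ℝ) (hr : r ∈ Icc τ₀ s) := (hD r ⟨hr.1, by linarith [hr.2, hs.2]⟩).sub
        (hDsd r (by linarith [hr.2, hs.2]))
    have h0 : 0 < D τ₀ - Ds τ₀ := by
      simp only [hDs, sub_self, sub_zero, Real.one_rpow]
      linarith
    -- As long as D > Ds one has F > Fs, hence D - Ds is nondecreasing and cannot reach zero.
    refine pos_of_forall_lt_pos (y := fun r => D r - Ds r)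
      (fun r hr => (hd r hr).continuousAt.continuousWithinAt) h0 ?_
    intro t ht hpos
    refine h0.trans_le (le_of_hasDerivAt_nonneg (f := fun r => D r - Ds r) ht.1.le
      (fun r hr => (hd r ⟨hr.1, hr.2.trans ht.2⟩).continuousAt.continuousWithinAt)
      (fun r hr => hd r ⟨hr.1.le, hr.2.le.trans ht.2⟩) ?_)
    intro r hr
    have hr1 : r ∈ Ico τ₀ (τ₀ + 1) := ⟨hr.1.le, by linarith [hr.2, ht.2, hs.2]⟩
    have h1 := hcompF r hr1 fun x hx => hpos x ⟨hx.1, hx.2.trans hr.2⟩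
    have h2 := hD' r (Ico_subset_Icc_self hr1)
    have h3 := hDsle r hr1
    have hFs0 : 0 ≤ Fs r := mul_nonneg hY.le (Real.rpow_nonneg (by linarith [hr1.2]) _)
    have h4 : c * Fs r ^ p ≤ c * |F r| ^ p := by
      gcongr
      exact h1.le.trans (le_abs_self _)
    linarith
  obtain ⟨M, hM⟩ := isCompact_Icc.exists_bound_of_continuousOn
    (fun τ hτ => (hF τ hτ).continuousAt.continuousWithinAt : ContinuousOn F (Icc τ₀ (τ₀ + 1)))
  have hM0 : 0 ≤ M := (norm_nonneg _).trans (hM τ₀ ⟨le_rfl, by linarith⟩)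
  -- The remaining time at which the barrier equals M + Y, beyond the bound M of F on the closed
  -- interval.
  set θ := (Y / (M + Y)) ^ (1 / q) with hθ
  have hr0 : 0 < Y / (M + Y) := by positivity
  have hθ0 : 0 < θ := Real.rpow_pos_of_pos hr0 _
  have hθ1 : θ ≤ 1 := Real.rpow_le_one hr0.le ((div_le_one (by positivity)).2 (by linarith))
    (by positivity)
  have hs : τ₀ + 1 - θ ∈ Ico τ₀ (τ₀ + 1) := ⟨by linarith, by linarith⟩
  have h1 := hcompF _ hs fun r hr => hcompD _ hs r (Ico_subset_Icc_self hr)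
  have h2 := (le_abs_self _).trans (hM _ (Ico_subset_Icc_self hs))
  have h3 : Fs (τ₀ + 1 - θ) = M + Y := by
    simp only [hFs]
    rw [show 1 - (τ₀ + 1 - θ - τ₀) = θ by ring, hθ, ← Real.rpow_mul hr0.le,
      show 1 / q * -q = -1 by field_simp, Real.rpow_neg_one]
    field_simp
  linarith

/-- The equation `A'' + μ₁/(1+t) A' + μ₂/(1+t)² A = k A + N` over `(0, T)` as a system for
`A` and `B = A'`. -/
structure MomentSystem (μ₁ μ₂ k T : ℝ) (A B N : ℝ → ℝ) : Prop where
  continuousOn_left : ContinuousOn A (Ico 0 T)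
  continuousOn_right : ContinuousOn B (Ico 0 T)
  hasDerivAt_left : ∀ t ∈ Ioo 0 T, HasDerivAt A (B t) t
  hasDerivAt_right : ∀ t ∈ Ioo 0 T,
    HasDerivAt B (k * A t - μ₁ / (1 + t) * B t - μ₂ / (1 + t) ^ 2 * A t + N t) t
  nonneg : ∀ t ∈ Ioo 0 T, 0 ≤ N t

theorem hasDerivAt_one_add_rpow (e : ℝ) {t : ℝ} (ht : 0 < 1 + t) :
    HasDerivAt (fun t : ℝ => (1 + t) ^ e) (e * ((1 + t) ^ e / (1 + t))) t := by
  have h1 : HasDerivAt (fun t : ℝ => 1 + t) 1 t := by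
    simpa using (hasDerivAt_id t).const_add 1
  refine (h1.rpow_const (p := e) (Or.inl ht.ne')).congr_deriv ?_
  rw [Real.rpow_sub_one ht.ne']; ring

/-! ### Factorisation and growth of the moment equation -/

namespace MomentSystem

variable {μ₁ μ₂ k T a κ : ℝ} {A B N : ℝ → ℝ}

/-- Used with e = a, where the bracket is the one in D and its sign makes (1+t)^a A monotone, and
with e = κ, the normalisation of F in logarithmic time. -/
theorem hasDerivAt_rpow_mul (h : MomentSystem μ₁ μ₂ k T A B N) {t : ℝ} (ht : t ∈ Ioo 0 T) (e : ℝ) :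
    HasDerivAt (fun t => (1 + t) ^ e * A t)
      ((1 + t) ^ e / (1 + t) * ((1 + t) * B t + e * A t)) t := by
  have hτ : 0 < 1 + t := by linarith [ht.1]
  refine ((hasDerivAt_one_add_rpow e hτ).mul (h.hasDerivAt_left t ht)).congr_deriv ?_
  field_simp
  ring

/-- The two conditions say that -a and -κ are the indicial roots of the Euler operator on the left,
which therefore splits into two first-order factors. -/
theorem hasDerivAt_weighted (h : MomentSystem μ₁ μ₂ k T A B N) (hs : a + κ = μ₁ - 1)
    (hm : a * κ = μ₂) {t : ℝ} (ht : t ∈ Ioo 0 T) :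
    HasDerivAt (fun t => (1 + t) ^ κ * ((1 + t) * B t + a * A t))
      ((1 + t) ^ κ * (1 + t) * (k * A t + N t)) t := by
  have hτ : 0 < 1 + t := by linarith [ht.1]
  have h1 : HasDerivAt (fun t : ℝ => 1 + t) 1 t := by
    simpa using (hasDerivAt_id t).const_add 1
  refine ((hasDerivAt_one_add_rpow κ hτ).mul ((h1.mul (h.hasDerivAt_right t ht)).add
    ((h.hasDerivAt_left t ht).const_mul a))).congr_deriv ?_
  obtain rfl : μ₁ = a + κ + 1 := by linarith
  subst hm
  simp only [Pi.add_apply, Pi.mul_apply]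
  field_simp
  ring

theorem continuousOn_weighted (h : MomentSystem μ₁ μ₂ k T A B N) (a κ : ℝ) :
    ContinuousOn (fun t => (1 + t) ^ κ * ((1 + t) * B t + a * A t)) (Ico 0 T) := by
  refine ContinuousOn.mul (ContinuousOn.rpow_const (by fun_prop) fun t ht => Or.inl ?_)
    (((by fun_prop : ContinuousOn (fun t : ℝ => 1 + t) (Ico 0 T)).mul h.continuousOn_right).add
      (h.continuousOn_left.const_smul a))
  linarith [ht.1]

theorem continuousOn_rpow_mul (h : MomentSystem μ₁ μ₂ k T A B N) (e : ℝ) :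
    ContinuousOn (fun t => (1 + t) ^ e * A t) (Ico 0 T) := by
  refine ContinuousOn.mul (ContinuousOn.rpow_const (by fun_prop) fun t ht => Or.inl ?_)
    h.continuousOn_left
  linarith [ht.1]

/-- Positivity of D makes (1+t)^a A nondecreasing, so A ≥ 0, so D' ≥ 0 and D keeps its initial lower
bound. Continuous induction closes the circle. -/
theorem nonneg_and_le_weighted (h : MomentSystem μ₁ μ₂ k T A B N) (hs : a + κ = μ₁ - 1)
    (hm : a * κ = μ₂) (hk : 0 ≤ k) {m₀ : ℝ} (hm₀ : 0 < m₀) (hA0 : 0 ≤ A 0)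
    (hD0 : m₀ ≤ a * A 0 + B 0) {t : ℝ} (ht : t ∈ Ico 0 T) :
    0 ≤ A t ∧ m₀ ≤ (1 + t) ^ κ * ((1 + t) * B t + a * A t) := by
  set D := fun t => (1 + t) ^ κ * ((1 + t) * B t + a * A t) with hDdef
  have hD0' : D 0 = a * A 0 + B 0 := by simp [hDdef]; ring
  have hIcc {s : ℝ} (hs : s ∈ Icc 0 t) : Icc 0 s ⊆ Ico 0 T := fun r hr =>
    ⟨hr.1, (hr.2.trans hs.2).trans_lt ht.2⟩
  have hApos (s : ℝ) (hst : s ∈ Icc 0 t) (hpos : ∀ r ∈ Ico 0 s, 0 < D r) : 0 ≤ A s := by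
    have := le_of_hasDerivAt_nonneg hst.1 ((h.continuousOn_rpow_mul a).mono (hIcc hst))
      (fun r hr => h.hasDerivAt_rpow_mul ⟨hr.1, (hIcc hst (Ioo_subset_Icc_self hr)).2⟩ a) ?_
    · simp only [add_zero, Real.one_rpow, one_mul] at this
      exact nonneg_of_mul_nonneg_right (hA0.trans this)
        (Real.rpow_pos_of_pos (by linarith [hst.1]) _)
    · intro r hr
      have hr1 : 0 < 1 + r := by linarith [hr.1]
      have := pos_of_mul_pos_right (hpos r ⟨hr.1.le, hr.2⟩) (Real.rpow_nonneg hr1.le _)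
      positivity
  have hDge (s : ℝ) (hst : s ∈ Icc 0 t) (hpos : ∀ r ∈ Ico 0 s, 0 < D r) : m₀ ≤ D s := by
    refine (hD0.trans hD0'.ge).trans (le_of_hasDerivAt_nonneg hst.1
      ((h.continuousOn_weighted a κ).mono (hIcc hst)) (fun r hr => h.hasDerivAt_weighted hs hm
        ⟨hr.1, (hIcc hst (Ioo_subset_Icc_self hr)).2⟩) ?_)
    intro r hr
    have hr1 : 0 < 1 + r := by linarith [hr.1]
    have h1 := hApos r ⟨hr.1.le, hr.2.le.trans hst.2⟩ fun x hx => hpos x ⟨hx.1, hx.2.trans hr.2⟩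
    have h2 := h.nonneg r ⟨hr.1, (hIcc hst (Ioo_subset_Icc_self hr)).2⟩
    positivity
  have hpos := pos_of_forall_lt_pos (y := D)
    ((h.continuousOn_weighted a κ).mono (hIcc (right_mem_Icc.2 ht.1))) (by linarith)
    fun s hst hp => hm₀.trans_le (hDge s (Ioc_subset_Icc_self hst) hp)
  have htt : t ∈ Icc 0 t := right_mem_Icc.2 ht.1
  exact ⟨hApos t htt fun r hr => hpos r (Ico_subset_Icc_self hr),
    hDge t htt fun r hr => hpos r (Ico_subset_Icc_self hr)⟩

/-- The moment against a plane wave grows at least like `e ^ t (1 + t) ^ (-μ₁ / 2)`. -/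
theorem exp_growth (hs : a + κ = μ₁ - 1) (hm : a * κ = μ₂) (hκ : κ ≤ a) :
    ∃ c : ℝ, 0 < c ∧ ∀ {T : ℝ} {A B N : ℝ → ℝ} {m₀ : ℝ}, MomentSystem μ₁ μ₂ 1 T A B N → 0 < m₀ →
      0 ≤ A 0 → m₀ ≤ a * A 0 + B 0 → ∀ t, 2 + (a - κ) ≤ t → t < T →
        c * m₀ * (Real.exp t * (1 + t) ^ (-(μ₁ / 2))) ≤ A t := by
  -- At this time the coefficient of A in Z below is at least a/(1+t₀), so the lower bound for D
  -- becomes one for Z.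
  set t₀ := 1 + (a - κ) with ht₀
  have ht₀1 : 1 ≤ t₀ := by linarith
  set m := μ₁ / 2 with hmdef
  set c₀ := Real.exp (-(t₀ + 1)) * (1 + t₀) ^ (m - κ - 1) with hc₀
  have hc₀pos : 0 < c₀ := mul_pos (Real.exp_pos _) (Real.rpow_pos_of_pos (by linarith) _)
  refine ⟨c₀ / 4 * Real.exp (-1), by positivity, ?_⟩
  intro T A B N m₀ h hm₀ hA0 hD0 t ht htT
  -- With W = (1+t)^(μ₁/2) A the equation is W'' = (1 + ((a-κ)² - 1)/(4(1+t)²)) W + (1+t)^(μ₁/2) N,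
  -- and Z = W' + S' W. The correction (1+t)⁻¹ to the phase t contributes 2/(1+t)², which outweighs
  -- the potential where (a-κ)² < 1 makes it negative.
  set S : ℝ → ℝ := fun t => t + (1 + t)⁻¹ with hS
  set Z : ℝ → ℝ := fun t => (1 + t) ^ m * (B t + (m / (1 + t) + 1 - 1 / (1 + t) ^ 2) * A t) with hZ
  have hpos (t : ℝ) (ht0 : 0 < t) (htT : t < T) := h.nonneg_and_le_weighted hs hm zero_le_one
    hm₀ hA0 hD0 ⟨ht0.le, htT⟩
  have hinv (t : ℝ) (ht0 : 0 < t) :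
      HasDerivAt (fun t : ℝ => (1 + t)⁻¹) (-1 / (1 + t) ^ 2) t := by
    have h1 : HasDerivAt (fun t : ℝ => 1 + t) 1 t := by
      simpa using (hasDerivAt_id t).const_add 1
    exact h1.inv (by linarith)
  have hSd (t : ℝ) (ht0 : 0 < t) : HasDerivAt S (1 - 1 / (1 + t) ^ 2) t := by
    refine ((hasDerivAt_id t).add (hinv t ht0)).congr_deriv ?_
    ring
  -- `e ^ (-S) Z` is nondecreasing
  have hZd (t : ℝ) (ht0 : t ∈ Ioo 0 T) : HasDerivAt (fun t => Real.exp (-S t) * Z t)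
      (Real.exp (-S t) * ((1 + t) ^ m * (N t + (((a - κ) ^ 2 - 1) / 4 / (1 + t) ^ 2
        + 2 / (1 + t) ^ 2 + 2 / (1 + t) ^ 3 - 1 / (1 + t) ^ 4) * A t))) t := by
    have hτ : 0 < 1 + t := by linarith [ht0.1]
    have hcoef : HasDerivAt (fun t : ℝ => m / (1 + t) + 1 - 1 / (1 + t) ^ 2)
        (-m / (1 + t) ^ 2 + 2 / (1 + t) ^ 3) t := by
      have e : (fun t : ℝ => m / (1 + t) + 1 - 1 / (1 + t) ^ 2)
          = fun t : ℝ => m * (1 + t)⁻¹ + 1 - (1 + t)⁻¹ * (1 + t)⁻¹ := by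
        ext t; simp [div_eq_mul_inv, sq]
      rw [e]
      refine (((((hinv t ht0.1).const_mul m).add_const 1).sub
        ((hinv t ht0.1).mul (hinv t ht0.1)))).congr_deriv ?_
      field_simp
      ring
    refine ((hSd t ht0.1).neg.exp.mul ((hasDerivAt_one_add_rpow m hτ).mul
      ((h.hasDerivAt_right t ht0).add (hcoef.mul (h.hasDerivAt_left t ht0))))).congr_deriv ?_
    have hμ : μ₁ = a + κ + 1 := by linarith
    have hm' : m = (a + κ + 1) / 2 := by rw [hmdef, hμ]
    simp only [Pi.add_apply, Pi.mul_apply, Pi.neg_apply]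
    rw [hm', hμ, ← hm]
    field_simp
    ring
  have hZge (t : ℝ) (ht1 : t₀ ≤ t) (htT : t < T) : c₀ * m₀ * Real.exp (S t) ≤ Z t := by
    have hmono := le_of_hasDerivAt_nonneg (a := t₀) (b := t) ht1
      (fun r hr => (hZd r ⟨by linarith [hr.1],
        hr.2.trans_lt htT⟩).continuousAt.continuousWithinAt)
      (fun r hr => hZd r ⟨by linarith [hr.1], hr.2.trans htT⟩) ?_
    · have hτ : 0 < 1 + t₀ := by linarith
      obtain ⟨hA, hD⟩ := hpos t₀ (by linarith) (by linarith)
      have e1 : (1 + t₀) ^ (m - κ - 1) * ((1 + t₀) ^ κ * ((1 + t₀) * B t₀ + a * A t₀))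
          = (1 + t₀) ^ m * (B t₀ + a / (1 + t₀) * A t₀) := by
        rw [Real.rpow_sub_one hτ.ne', Real.rpow_sub hτ]
        have := (Real.rpow_pos_of_pos hτ κ).ne'
        field_simp
      have e2 : a / (1 + t₀) ≤ m / (1 + t₀) + 1 - 1 / (1 + t₀) ^ 2 := by
        have : m = (a + κ + 1) / 2 := by rw [hmdef]; linarith
        have hak : a - κ = t₀ - 1 := by rw [ht₀]; ring
        rw [← sub_nonneg]
        have : m / (1 + t₀) + 1 - 1 / (1 + t₀) ^ 2 - a / (1 + t₀)
            = ((1 + t₀) ^ 2 - 1 - (1 + t₀) * ((a - κ) - 1) / 2) / (1 + t₀) ^ 2 := by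
          rw [this]; field_simp; ring
        rw [this, hak]
        apply div_nonneg _ (by positivity)
        nlinarith
      have e3 : (1 + t₀) ^ (m - κ - 1) * m₀ ≤ Z t₀ := by
        calc _ ≤ (1 + t₀) ^ (m - κ - 1) * ((1 + t₀) ^ κ * ((1 + t₀) * B t₀ + a * A t₀)) := by
              gcongr
          _ = _ := e1
          _ ≤ Z t₀ := by
              simp only [hZ]
              gcongr
      have e4 : Real.exp (-(t₀ + 1)) ≤ Real.exp (-S t₀) := by
        apply Real.exp_le_exp.2
        simp only [hS]
        have : (1 + t₀)⁻¹ ≤ 1 := inv_le_one_of_one_le₀ (by linarith)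
        linarith
      have e5 : c₀ * m₀ ≤ Real.exp (-S t) * Z t := by
        refine le_trans ?_ hmono
        calc c₀ * m₀ = Real.exp (-(t₀ + 1)) * ((1 + t₀) ^ (m - κ - 1) * m₀) := by
              rw [hc₀]; ring
          _ ≤ _ := by gcongr
      calc c₀ * m₀ * Real.exp (S t) ≤ Real.exp (-S t) * Z t * Real.exp (S t) := by gcongr
        _ = Z t * (Real.exp (-S t) * Real.exp (S t)) := by ring
        _ = Z t := by rw [← Real.exp_add]; simp
    · intro r hr
      have hτ : 1 ≤ 1 + r := by linarith [hr.1]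
      have hA := (hpos r (by linarith [hr.1]) (hr.2.trans htT)).1
      have hN := h.nonneg r ⟨by linarith [hr.1], hr.2.trans htT⟩
      have hc : 0 ≤ ((a - κ) ^ 2 - 1) / 4 / (1 + r) ^ 2 + 2 / (1 + r) ^ 2
        + 2 / (1 + r) ^ 3 - 1 / (1 + r) ^ 4 := by
        have : ((a - κ) ^ 2 - 1) / 4 / (1 + r) ^ 2 + 2 / (1 + r) ^ 2
            + 2 / (1 + r) ^ 3 - 1 / (1 + r) ^ 4
            = (((a - κ) ^ 2 + 7) / 4 * (1 + r) ^ 2 + 2 * (1 + r) - 1) / (1 + r) ^ 4 := by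
          field_simp
          ring
        rw [this]
        apply div_nonneg _ (by positivity)
        nlinarith [mul_nonneg (sq_nonneg (a - κ)) (sq_nonneg (1 + r))]
      have : 0 ≤ (1 + r) ^ m := Real.rpow_nonneg (by linarith) _
      positivity
  -- integrate `(e ^ S (1 + t) ^ m A)' = e ^ S Z ≥ c e ^ (2 t)`
  have hWd (t : ℝ) (ht0 : t ∈ Ioo 0 T) : HasDerivAt
      (fun t => Real.exp (S t) * ((1 + t) ^ m * A t) - c₀ * m₀ / 2 * Real.exp (2 * t))
      (Real.exp (S t) * Z t - c₀ * m₀ * Real.exp (2 * t)) t := by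
    have hτ : 0 < 1 + t := by linarith [ht0.1]
    have h2 : HasDerivAt (fun t : ℝ => Real.exp (2 * t)) (Real.exp (2 * t) * 2) t := by
      simpa using ((hasDerivAt_id t).const_mul 2).exp
    refine (((hSd t ht0.1).exp.mul ((hasDerivAt_one_add_rpow m hτ).mul
      (h.hasDerivAt_left t ht0))).sub (h2.const_mul (c₀ * m₀ / 2))).congr_deriv ?_
    simp only [hZ, Pi.mul_apply]
    field_simp
    ring
  have htt : t₀ ≤ t := by linarith
  have hmono := le_of_hasDerivAt_nonneg htt
      (fun r hr => (hWd r ⟨by linarith [hr.1],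
        hr.2.trans_lt htT⟩).continuousAt.continuousWithinAt)
      (fun r hr => hWd r ⟨by linarith [hr.1], hr.2.trans htT⟩) (fun r hr => by
        have h1 := hZge r hr.1.le (hr.2.trans htT)
        have hS0 : r ≤ S r := by
          simp only [hS]
          have : 0 < (1 + r)⁻¹ := inv_pos.2 (by linarith [hr.1])
          linarith
        have h2 : Real.exp (2 * r) ≤ Real.exp (S r) * Real.exp (S r) := by
          rw [← Real.exp_add]
          exact Real.exp_le_exp.2 (by linarith)
        have h3 : c₀ * m₀ * Real.exp (2 * r) ≤ Real.exp (S r) * Z r := by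
          calc _ ≤ c₀ * m₀ * (Real.exp (S r) * Real.exp (S r)) := by gcongr
            _ = Real.exp (S r) * (c₀ * m₀ * Real.exp (S r)) := by ring
            _ ≤ _ := by gcongr
        linarith)
  have hA0' : 0 ≤ Real.exp (S t₀) * ((1 + t₀) ^ m * A t₀) := by
    have := (hpos t₀ (by linarith) (by linarith)).1
    have : 0 ≤ (1 + t₀) ^ m := Real.rpow_nonneg (by linarith) _
    positivity
  -- Here t ≥ t₀ + 1 is spent: the boundary term at t₀ costs at most half of the growth.
  have hexp2 : Real.exp (2 * t₀) ≤ Real.exp (2 * t) / 2 := by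
    have h1 : Real.exp (2 * t) = Real.exp (2 * t₀) * Real.exp (2 * t - 2 * t₀) := by
      rw [← Real.exp_add]; congr 1; ring
    have h2 : 2 ≤ Real.exp (2 * t - 2 * t₀) := by
      have := Real.add_one_le_exp (2 * t - 2 * t₀)
      linarith
    rw [h1]
    nlinarith [Real.exp_pos (2 * t₀)]
  have hmain : c₀ * m₀ / 4 * Real.exp (2 * t) ≤ Real.exp (S t) * ((1 + t) ^ m * A t) := by
    have : c₀ * m₀ / 2 * Real.exp (2 * t₀) ≤ c₀ * m₀ / 2 * (Real.exp (2 * t) / 2) := by gcongr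
    linarith
  have hτ : 0 < 1 + t := by linarith
  have hSt : S t ≤ t + 1 := by
    simp only [hS]
    have : (1 + t)⁻¹ ≤ 1 := inv_le_one_of_one_le₀ (by linarith)
    linarith
  have hAt := (hpos t (by linarith) htT).1
  have hxm : 0 < (1 + t) ^ m := Real.rpow_pos_of_pos hτ _
  have h5 : c₀ * m₀ / 4 * Real.exp (2 * t) ≤ Real.exp (t + 1) * ((1 + t) ^ m * A t) :=
    hmain.trans (by gcongr)
  rw [Real.rpow_neg hτ.le]
  calc _ = c₀ * m₀ / 4 * Real.exp (2 * t) * (Real.exp (-(t + 1)) * ((1 + t) ^ m)⁻¹) := by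
        have : Real.exp (2 * t) * Real.exp (-(t + 1)) = Real.exp (-1) * Real.exp t := by
          rw [← Real.exp_add, ← Real.exp_add]; congr 1; ring
        linear_combination (-c₀ * m₀ / 4 * ((1 + t) ^ m)⁻¹) * this
    _ ≤ Real.exp (t + 1) * ((1 + t) ^ m * A t) * (Real.exp (-(t + 1)) * ((1 + t) ^ m)⁻¹) := by
        gcongr
    _ = (Real.exp (t + 1) * Real.exp (-(t + 1))) * ((1 + t) ^ m * ((1 + t) ^ m)⁻¹) * A t := by ring
    _ = A t := by
        rw [← Real.exp_add, mul_inv_cancel₀ hxm.ne']; simp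

end MomentSystem

/-! ### Blow-up in logarithmic time -/

/-- The system `F' = D - b F`, `D' = P ≥ 0` over `(0, S)` with `F ≥ 0` and `D ≥ m`. -/
structure LogSystem (b m S : ℝ) (F D P : ℝ → ℝ) : Prop where
  continuousOn_left : ContinuousOn F (Ico 0 S)
  nonneg : ∀ τ ∈ Ico 0 S, 0 ≤ F τ
  le_right : ∀ τ ∈ Ico 0 S, m ≤ D τ
  hasDerivAt_left : ∀ τ ∈ Ioo 0 S, HasDerivAt F (D τ - b * F τ) τ
  hasDerivAt_right : ∀ τ ∈ Ioo 0 S, HasDerivAt D (P τ) τ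

/-- Passage to the time `τ = log (1 + t)`. -/
theorem MomentSystem.logSystem {μ₁ μ₂ T a κ m₀ : ℝ} {A B N : ℝ → ℝ}
    (h : MomentSystem μ₁ μ₂ 0 T A B N) (hs : a + κ = μ₁ - 1)
    (hm : a * κ = μ₂) (hm₀ : 0 < m₀) (hA0 : 0 ≤ A 0) (hD0 : m₀ ≤ a * A 0 + B 0) (hT : 0 < T) :
    LogSystem (a - κ) m₀ (Real.log (1 + T))
      (fun τ => (1 + (Real.exp τ - 1)) ^ κ * A (Real.exp τ - 1))
      (fun τ => (1 + (Real.exp τ - 1)) ^ κ *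
        ((1 + (Real.exp τ - 1)) * B (Real.exp τ - 1) + a * A (Real.exp τ - 1)))
      (fun τ => Real.exp ((2 + κ) * τ) * N (Real.exp τ - 1)) := by
  have hlt {τ : ℝ} (hτ : τ < Real.log (1 + T)) : Real.exp τ - 1 < T := by
    have := (Real.lt_log_iff_exp_lt (by linarith)).1 hτ
    linarith
  have hco {τ : ℝ} (hτ : τ ∈ Ico 0 (Real.log (1 + T))) : Real.exp τ - 1 ∈ Ico 0 T :=
    ⟨by linarith [Real.one_le_exp hτ.1], hlt hτ.2⟩
  have hoo {τ : ℝ} (hτ : τ ∈ Ioo 0 (Real.log (1 + T))) : Real.exp τ - 1 ∈ Ioo 0 T :=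
    ⟨by linarith [Real.one_lt_exp_iff.2 hτ.1], hlt hτ.2⟩
  have hexp (τ : ℝ) : HasDerivAt (fun τ => Real.exp τ - 1) (Real.exp τ) τ :=
    (Real.hasDerivAt_exp τ).sub_const 1
  refine ⟨?_, ?_, ?_, ?_, ?_⟩
  · exact (h.continuousOn_rpow_mul κ).comp (by fun_prop) fun τ hτ => hco hτ
  · intro τ hτ
    have := (h.nonneg_and_le_weighted hs hm le_rfl hm₀ hA0 hD0 (hco hτ)).1
    have : 0 ≤ (1 + (Real.exp τ - 1)) ^ κ := Real.rpow_nonneg (by linarith [(hco hτ).1]) _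
    positivity
  · exact fun τ hτ => (h.nonneg_and_le_weighted hs hm le_rfl hm₀ hA0 hD0 (hco hτ)).2
  · intro τ hτ
    refine ((h.hasDerivAt_rpow_mul (hoo hτ) κ).comp τ (hexp τ)).congr_deriv ?_
    simp only [add_sub_cancel]
    field_simp
    ring
  · intro τ hτ
    refine ((h.hasDerivAt_weighted hs hm (hoo hτ)).comp τ (hexp τ)).congr_deriv ?_
    simp only [add_sub_cancel]
    rw [← Real.exp_mul, show (2 + κ) * τ = τ * κ + τ + τ by ring, Real.exp_add, Real.exp_add]
    ring

namespace LogSystem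

/-- A solution of `F' = D - b F`, `D' ≥ c e ^ (γ τ) F ^ p` cannot exist much longer than a time at
which both components are large on the natural scale `e ^ (-γ τ / (p - 1))`. -/
theorem le_of_large {p b γ c : ℝ} (hp : 1 < p) (hb : 0 ≤ b) (hc : 0 < c) :
    ∃ K : ℝ, 0 < K ∧ ∀ {m S : ℝ} {F D P : ℝ → ℝ}, LogSystem b m S F D P →
      (∀ τ ∈ Ioo 0 S, c * (Real.exp (γ * τ) * F τ ^ p) ≤ P τ) → ∀ τ₀, 0 < τ₀ →
      K * Real.exp (-(γ / (p - 1)) * τ₀) ≤ F τ₀ → K * Real.exp (-(γ / (p - 1)) * τ₀) ≤ D τ₀ →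
        S ≤ τ₀ + 1 := by
  have hp1 : 0 < p - 1 := by linarith
  set q := 2 / (p - 1) with hq
  have hq0 : 0 < q := by positivity
  set C := q * (q + 1) + b * q with hC
  have hC0 : 0 < C := by positivity
  -- Solves c e^{-|γ|} K₁^(p-1) = C, where e^{-|γ|} is the loss from freezing e^{γτ} at τ₀ over one
  -- unit of time.
  set K₁ := (C / (c * Real.exp (-|γ|))) ^ (1 / (p - 1)) with hK₁
  have hK₁0 : 0 < K₁ := by positivity
  -- The factor 1 + q + b strictly exceeds both 1 and q + b, the initial values that the barrier
  -- requires of F and D.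
  refine ⟨K₁ * (1 + q + b), by positivity, ?_⟩
  intro m S F D P h hP τ₀ hτ₀ hF hD
  by_contra! hS
  set Y := K₁ * Real.exp (-(γ / (p - 1)) * τ₀) with hY
  have hY0 : 0 < Y := by positivity
  have hsub : Icc τ₀ (τ₀ + 1) ⊆ Ioo 0 S := fun τ hτ => ⟨hτ₀.trans_le hτ.1, hτ.2.trans_lt hS⟩
  have hYp : c * Real.exp (γ * τ₀ - |γ|) * Y ^ (p - 1) = C := by
    rw [hY, Real.mul_rpow hK₁0.le (Real.exp_pos _).le, hK₁, ← Real.rpow_mul (by positivity),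
      one_div_mul_cancel hp1.ne', Real.rpow_one, ← Real.exp_mul, sub_eq_add_neg, Real.exp_add,
      show -(γ / (p - 1)) * τ₀ * (p - 1) = -(γ * τ₀) by field_simp, Real.exp_neg (γ * τ₀)]
    field_simp
  have hE : K₁ * (1 + q + b) * Real.exp (-(γ / (p - 1)) * τ₀) = Y * (1 + q + b) := by
    rw [hY]; ring
  rw [hE] at hF hD
  have hqb : 0 < Y * (q + b) := by positivity
  refine blowup_unit_time hp hb (c := c * Real.exp (γ * τ₀ - |γ|)) (by positivity) hY0 hYp.ge
    (fun τ hτ => h.hasDerivAt_left τ (hsub hτ)) (fun τ hτ => h.hasDerivAt_right τ (hsub hτ))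
    (fun τ hτ => ?_) (by linarith) (by linarith)
  have hF0 := h.nonneg τ (Ioo_subset_Ico_self (hsub hτ))
  refine le_trans ?_ (hP τ (hsub hτ))
  rw [abs_of_nonneg hF0, mul_assoc]
  have : γ * τ₀ - |γ| ≤ γ * τ := by
    have h1 : 0 ≤ τ - τ₀ := by linarith [hτ.1]
    have h2 : |γ| * (τ - τ₀) ≤ |γ| := mul_le_of_le_one_right (abs_nonneg _) (by linarith [hτ.2])
    have h3 : -|γ| * (τ - τ₀) ≤ γ * (τ - τ₀) := by gcongr; exact neg_abs_le γ
    linarith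
  gcongr

/-- A lower bound for `F` in terms of one for `D` over the preceding unit of time. -/
theorem le_left_of_le_right {b m S : ℝ} {F D P : ℝ → ℝ} (hb : 0 ≤ b) (h : LogSystem b m S F D P)
    {d σ τ : ℝ} (hd : 0 ≤ d) (hσ : 0 ≤ σ) (hστ : σ ≤ τ) (hτ : τ < S)
    (hD : ∀ r ∈ Ioo σ τ, d ≤ D r) : Real.exp (b * (σ - τ)) * d * (τ - σ) ≤ F τ := by
  have hsub : Icc σ τ ⊆ Ico 0 S := fun r hr => ⟨hσ.trans hr.1, hr.2.trans_lt hτ⟩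
  have := add_mul_le_of_le_hasDerivAt (f := fun r => Real.exp (b * r) * F r)
    (f' := fun r => Real.exp (b * r) * D r) (m := Real.exp (b * σ) * d) hστ
    (ContinuousOn.mul (by fun_prop) (h.continuousOn_left.mono hsub)) (fun r hr => by
      have hexp : HasDerivAt (fun r => Real.exp (b * r)) (Real.exp (b * r) * b) r := by
        simpa using ((hasDerivAt_id r).const_mul b).exp
      refine (hexp.mul (h.hasDerivAt_left r
        ⟨hσ.trans_lt hr.1, hr.2.trans hτ⟩)).congr_deriv ?_
      ring) (fun r hr => by
      have := hD r hr
      have hr1 := hr.1.le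
      gcongr)
  have hF0 : 0 ≤ Real.exp (b * σ) * F σ :=
    mul_nonneg (Real.exp_pos _).le (h.nonneg σ (hsub (left_mem_Icc.2 hστ)))
  calc Real.exp (b * (σ - τ)) * d * (τ - σ)
      = Real.exp (-(b * τ)) * (Real.exp (b * σ) * d * (τ - σ)) := by
        rw [show b * (σ - τ) = -(b * τ) + b * σ by ring, Real.exp_add]; ring
    _ ≤ Real.exp (-(b * τ)) * (Real.exp (b * τ) * F τ) :=
        mul_le_mul_of_nonneg_left (by linarith) (Real.exp_pos _).le
    _ = F τ := by rw [← mul_assoc, ← Real.exp_add]; simp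

/-- Freezes an exponential weight at the right end of a short interval, whatever the sign of γ. -/
theorem exp_mul_ge {γ σ τ : ℝ} (h : σ ≤ τ) {L : ℝ} (hL : τ - σ ≤ L) :
    Real.exp (-(|γ| * L)) * Real.exp (γ * τ) ≤ Real.exp (γ * σ) := by
  rw [← Real.exp_add]
  apply Real.exp_le_exp.2
  have h1 : γ * (τ - σ) ≤ |γ| * (τ - σ) :=
    mul_le_mul_of_nonneg_right (le_abs_self _) (by linarith)
  have h2 : |γ| * (τ - σ) ≤ |γ| * L := by gcongr
  linarith

/-- Lower bound for the increase of `D` over a time interval. -/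
theorem le_right_of_le {b m S : ℝ} {F D P : ℝ → ℝ} (hm : 0 ≤ m) (h : LogSystem b m S F D P)
    {d σ τ : ℝ} (hσ : 0 < σ) (hστ : σ ≤ τ) (hτ : τ < S)
    (hP : ∀ r ∈ Ioo σ τ, d ≤ P r) : d * (τ - σ) ≤ D τ := by
  have hsub : Icc σ τ ⊆ Ioo 0 S := fun r hr => ⟨hσ.trans_le hr.1, hr.2.trans_lt hτ⟩
  have := add_mul_le_of_le_hasDerivAt hστ
    (fun r hr => (h.hasDerivAt_right r (hsub hr)).continuousAt.continuousWithinAt)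
    (fun r hr => h.hasDerivAt_right r (hsub (Ioo_subset_Icc_self hr))) hP
  have hD0 := h.le_right σ (Ioo_subset_Ico_self (hsub (left_mem_Icc.2 hστ)))
  linarith

/-- Blow-up driven by the mass of the data. -/
theorem le_of_heat {p b γ c H : ℝ} (hp : 1 < p) (hb : 0 ≤ b) (hc : 0 < c) (hH : 0 < H) :
    ∃ K : ℝ, 0 < K ∧ ∀ {ε S : ℝ} {F D P : ℝ → ℝ}, 0 < ε → LogSystem b (ε * H) S F D P →
      (∀ τ ∈ Ioo 0 S, c * (Real.exp (γ * τ) * F τ ^ p) ≤ P τ) → ∀ τ₀, 2 ≤ τ₀ →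
      K ≤ ε * (if b = 0 then τ₀ else 1) * Real.exp (γ / (p - 1) * τ₀) → S ≤ τ₀ + 1 := by
  have hp1 : 0 < p - 1 := by linarith
  obtain ⟨K₀, hK₀, hlarge⟩ := le_of_large (γ := γ) hp hb hc
  -- Under D ≥ εH alone, F grows linearly without damping and is only kept of order ε with it.
  set ℓ : ℝ → ℝ := fun τ => if b = 0 then τ else 1 with hℓ
  set c₁ := Real.exp (-b) * H with hc₁
  have hc₁0 : 0 < c₁ := by positivity
  set c₂ := c * (Real.exp (-(|γ| * 1)) * (c₁ / 2) ^ p) with hc₂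
  have hc₂0 : 0 < c₂ := by positivity
  -- The first entry makes F large at τ₀, the second makes D large.
  refine ⟨max (K₀ / c₁) ((K₀ / c₂) ^ (1 / p)), lt_max_of_lt_left (by positivity), ?_⟩
  intro ε S F D P hε h hP τ₀ hτ₀ hK
  by_contra! hS
  have hℓpos (τ : ℝ) (hτ : 1 ≤ τ) : 0 < ℓ τ := by
    simp only [hℓ]; split_ifs <;> linarith
  have hFlow (τ : ℝ) (hτ : 1 ≤ τ) (hτS : τ < S) : c₁ * (ε * ℓ τ) ≤ F τ := by
    by_cases hb0 : b = 0
    · have := h.le_left_of_le_right hb (d := ε * H) (by positivity) le_rfl (by linarith) hτS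
        fun r hr => h.le_right r ⟨hr.1.le, hr.2.trans hτS⟩
      simp only [hℓ, hc₁, hb0, zero_mul, Real.exp_zero, sub_zero, if_true, neg_zero] at this ⊢
      linarith
    · have := h.le_left_of_le_right hb (d := ε * H) (σ := τ - 1) (by positivity) (by linarith)
        (by linarith) hτS
        fun r hr => h.le_right r ⟨by linarith [hr.1], hr.2.trans hτS⟩
      simp only [hℓ, hc₁, hb0, if_false]
      rw [show b * (τ - 1 - τ) = -b by ring] at this
      linarith
  set X := ε * ℓ τ₀ * Real.exp (γ / (p - 1) * τ₀) with hX
  have hX0 : 0 < X := by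
    have := hℓpos τ₀ (by linarith)
    positivity
  have hXdef : ε * ℓ τ₀ = X * Real.exp (-(γ / (p - 1)) * τ₀) := by
    rw [hX, mul_assoc, ← Real.exp_add]; simp
  have hKX1 : K₀ ≤ c₁ * X := by
    have := (le_max_left _ _).trans hK
    rwa [div_le_iff₀' hc₁0] at this
  have hKX2 : K₀ ≤ c₂ * X ^ p := by
    have := (le_max_right _ _).trans hK
    have := Real.rpow_le_rpow (by positivity) this (by linarith : 0 ≤ p)
    rw [← Real.rpow_mul (by positivity), one_div_mul_cancel (by linarith), Real.rpow_one] at this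
    rwa [div_le_iff₀' hc₂0] at this
  have hE0 := Real.exp_pos (-(γ / (p - 1)) * τ₀)
  refine absurd (hlarge h hP τ₀ (by linarith) ?_ ?_) (not_le.2 hS)
  · calc _ ≤ c₁ * X * Real.exp (-(γ / (p - 1)) * τ₀) := by gcongr
      _ = c₁ * (ε * ℓ τ₀) := by rw [hXdef]; ring
      _ ≤ _ := hFlow τ₀ (by linarith) (by linarith)
  · have hD := h.le_right_of_le (by positivity) (σ := τ₀ - 1) (τ := τ₀)
      (d := c₂ * (Real.exp (γ * τ₀) * (ε * ℓ τ₀) ^ p)) (by linarith) (by linarith) (by linarith) ?_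
    · rw [sub_sub_cancel, mul_one] at hD
      refine le_trans ?_ hD
      -- The gain of D over one unit of time is again on the natural scale, because γ - pγ/(p-1) =
      -- -γ/(p-1).
      have : Real.exp (γ * τ₀) * (ε * ℓ τ₀) ^ p = X ^ p * Real.exp (-(γ / (p - 1)) * τ₀) := by
        rw [hXdef, Real.mul_rpow hX0.le hE0.le, ← Real.exp_mul,
          mul_left_comm, ← Real.exp_add]
        congr 2
        field_simp
        ring
      rw [this, ← mul_assoc]
      gcongr
    · intro r hr
      refine le_trans ?_ (hP r ⟨by linarith [hr.1], by linarith [hr.2]⟩)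
      have hr1 : 1 ≤ r := by linarith [hr.1]
      have h1 := hFlow r hr1 (by linarith [hr.2])
      -- On the last unit before τ₀ ≥ 2 one has r ≥ τ₀/2.
      have h2 : ℓ τ₀ / 2 ≤ ℓ r := by
        simp only [hℓ]; split_ifs <;> linarith [hr.1]
      have h3 : c₁ / 2 * (ε * ℓ τ₀) ≤ F r := by
        calc _ = c₁ * (ε * (ℓ τ₀ / 2)) := by ring
          _ ≤ c₁ * (ε * ℓ r) := by gcongr
          _ ≤ _ := h1
      have hεℓ : 0 < ε * ℓ τ₀ := mul_pos hε (hℓpos τ₀ (by linarith))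
      calc _ = c * ((Real.exp (-(|γ| * 1)) * Real.exp (γ * τ₀)) * (c₁ / 2 * (ε * ℓ τ₀)) ^ p) := by
            rw [Real.mul_rpow (by positivity) hεℓ.le, hc₂]; ring
        _ ≤ c * (Real.exp (γ * r) * F r ^ p) := by
            have := exp_mul_ge (γ := γ) hr.2.le (L := 1) (by linarith [hr.1])
            gcongr

/-- Blow-up driven by a lower bound for the nonlinearity. -/
theorem le_of_wave {p b γ c c' β τ₁ : ℝ} (hp : 1 < p) (hb : 0 ≤ b) (hc : 0 < c) (hc' : 0 < c')
    (hτ₁ : 0 ≤ τ₁) :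
    ∃ K : ℝ, 0 < K ∧ ∀ {m e S : ℝ} {F D P : ℝ → ℝ}, 0 ≤ m → 0 < e → LogSystem b m S F D P →
      (∀ τ ∈ Ioo 0 S, c * (Real.exp (γ * τ) * F τ ^ p) ≤ P τ) →
      (∀ τ ∈ Ioo 0 S, τ₁ ≤ τ → c' * (e * Real.exp (β * τ)) ≤ P τ) → ∀ τ₀, τ₁ + 3 ≤ τ₀ →
      K ≤ e * Real.exp ((β + γ / (p - 1)) * τ₀) → S ≤ τ₀ + 1 := by
  obtain ⟨K₀, hK₀, hlarge⟩ := le_of_large (γ := γ) hp hb hc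
  -- F at τ₀ is fed by D on the last unit of time, and D there by P on the last two units, whence
  -- the 2. The condition τ₁ + 3 ≤ τ₀ keeps this window beyond τ₁.
  set c₁ := c' * Real.exp (-(|β| * 2)) with hc₁
  have hc₁0 : 0 < c₁ := by positivity
  refine ⟨K₀ / (c₁ * Real.exp (-b)), by positivity, ?_⟩
  intro m e S F D P hm he h hP hP' τ₀ hτ₀ hK
  by_contra! hS
  rw [div_le_iff₀' (by positivity)] at hK
  set d := c₁ * (e * Real.exp (β * τ₀)) with hd
  have hd0 : 0 < d := by positivity
  have hD (τ : ℝ) (hτ : τ₀ - 1 ≤ τ) (hτ' : τ ≤ τ₀) : d ≤ D τ := by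
    have := h.le_right_of_le hm (σ := τ - 1) (τ := τ) (d := d) (by linarith) (by linarith)
      (by linarith) ?_
    · simpa using this
    · intro r hr
      refine le_trans ?_ (hP' r ⟨by linarith [hr.1], by linarith [hr.2]⟩ (by linarith [hr.1]))
      calc d = c' * (e * (Real.exp (-(|β| * 2)) * Real.exp (β * τ₀))) := by rw [hd, hc₁]; ring
        _ ≤ _ := by
          have := exp_mul_ge (γ := β) (σ := r) (τ := τ₀) (by linarith [hr.2]) (L := 2)
            (by linarith [hr.1])
          gcongr
  have hKd : K₀ * Real.exp (-(γ / (p - 1)) * τ₀) ≤ Real.exp (-b) * d := by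
    calc _ ≤ c₁ * Real.exp (-b) * (e * Real.exp ((β + γ / (p - 1)) * τ₀))
            * Real.exp (-(γ / (p - 1)) * τ₀) := by gcongr
      _ = c₁ * Real.exp (-b) * e * (Real.exp ((β + γ / (p - 1)) * τ₀)
            * Real.exp (-(γ / (p - 1)) * τ₀)) := by ring
      _ = _ := by
        rw [← Real.exp_add, hd]; ring_nf
  refine absurd (hlarge h hP τ₀ (by linarith) ?_ ?_) (not_le.2 hS)
  · have := h.le_left_of_le_right hb (d := d) (σ := τ₀ - 1) (τ := τ₀) hd0.le (by linarith)
      (by linarith) (by linarith) fun r hr => hD r hr.1.le hr.2.le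
    rw [show b * (τ₀ - 1 - τ₀) = -b by ring, sub_sub_cancel, mul_one] at this
    exact hKd.trans this
  · refine hKd.trans (le_trans ?_ (hD τ₀ (by linarith) le_rfl))
    exact mul_le_of_le_one_left hd0.le (Real.exp_le_one_iff.2 (by linarith))

end LogSystem

/-! ### Averages of plane waves over directions -/

/-- The average of the plane waves `e ^ ⟪x, ω⟫` over directions `ω = y / ‖y‖`, where `y` ranges over
an annulus. -/
noncomputable def waveAverage {n : ℕ} (x : Space n) : ℝ :=
  ∫ y in Metric.closedBall (0 : Space n) 2 \ Metric.ball 0 1, Real.exp (inner ℝ x (‖y‖⁻¹ • y))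

theorem measurableSet_annulus (n : ℕ) :
    MeasurableSet (Metric.closedBall (0 : Space n) 2 \ Metric.ball 0 1) :=
  measurableSet_closedBall.diff measurableSet_ball

theorem volume_annulus_ne_top (n : ℕ) :
    volume (Metric.closedBall (0 : Space n) 2 \ Metric.ball 0 1) ≠ ⊤ :=
  ((measure_mono sdiff_subset).trans_lt measure_closedBall_lt_top).ne

theorem volume_annulus_pos {n : ℕ} (hn : 1 ≤ n) :
    0 < volume.real (Metric.closedBall (0 : Space n) 2 \ Metric.ball 0 1) := by
  have : NeZero n := ⟨by omega⟩
  refine ENNReal.toReal_pos ?_ (volume_annulus_ne_top n)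
  have hopen : IsOpen (Metric.ball (0 : Space n) 2 \ Metric.closedBall 0 1) :=
    Metric.isOpen_ball.sdiff Metric.isClosed_closedBall
  have hne : (Metric.ball (0 : Space n) 2 \ Metric.closedBall 0 1).Nonempty := by
    refine ⟨EuclideanSpace.single 0 (3 / 2), ?_⟩
    simp only [Set.mem_sdiff, Metric.mem_ball, dist_zero_right, Metric.mem_closedBall,
      PiLp.norm_single]
    norm_num
  exact (hopen.measure_pos volume hne |>.trans_le (measure_mono
    (sdiff_subset_sdiff Metric.ball_subset_closedBall Metric.ball_subset_closedBall))).ne'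

theorem measurable_direction (n : ℕ) : Measurable fun y : Space n => ‖y‖⁻¹ • y :=
  measurable_norm.inv.smul measurable_id

theorem norm_direction {n : ℕ} {y : Space n}
    (hy : y ∈ Metric.closedBall (0 : Space n) 2 \ Metric.ball 0 1) : ‖‖y‖⁻¹ • y‖ = 1 := by
  have h1 : 1 ≤ ‖y‖ := by simpa using hy.2
  rw [norm_smul, norm_inv, norm_norm, inv_mul_cancel₀ (by linarith)]

theorem measurable_waveAverage (n : ℕ) : Measurable (waveAverage (n := n)) := by
  have : Measurable fun z : Space n × Space n => Real.exp (inner ℝ z.1 (‖z.2‖⁻¹ • z.2)) :=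
    Real.measurable_exp.comp (measurable_fst.inner ((measurable_direction n).comp measurable_snd))
  exact (this.stronglyMeasurable.integral_prod_right'
    (ν := volume.restrict (Metric.closedBall (0 : Space n) 2 \ Metric.ball 0 1))).measurable

theorem waveAverage_nonneg {n : ℕ} (x : Space n) : 0 ≤ waveAverage x :=
  integral_nonneg fun _ => (Real.exp_pos _).le

/-- Anisotropic Gaussian integrals. -/
theorem integrable_and_integral_gaussian_orthonormal {n : ℕ}
    (b : OrthonormalBasis (Fin n) ℝ (Space n)) {w : Fin n → ℝ} (hw : ∀ i, 0 < w i) :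
    Integrable (fun y => Real.exp (-∑ i, w i * inner ℝ (b i) y ^ 2)) ∧
    ∫ y, Real.exp (-∑ i, w i * inner ℝ (b i) y ^ 2) = ∏ i, Real.sqrt (Real.pi / w i) := by
  have hmp : MeasurePreserving (fun y => WithLp.ofLp (b.repr y)) volume volume :=
    (PiLp.volume_preserving_ofLp (Fin n)).comp b.measurePreserving_repr
  have hme : MeasurableEmbedding (fun y => WithLp.ofLp (b.repr y)) :=
    (MeasurableEquiv.toLp 2 (Fin n → ℝ)).symm.measurableEmbedding.comp
      b.measurableEquiv.measurableEmbedding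
  have e : (fun y => Real.exp (-∑ i, w i * inner ℝ (b i) y ^ 2))
      = (fun z : Fin n → ℝ => ∏ i, Real.exp (-w i * z i ^ 2)) ∘
        fun y => WithLp.ofLp (b.repr y) := by
    ext y
    simp only [Function.comp, ← Real.exp_sum, b.repr_apply_apply]
    congr 1
    rw [← Finset.sum_neg_distrib]
    exact Finset.sum_congr rfl fun i _ => by ring
  rw [e]
  constructor
  · exact (hmp.integrable_comp_emb hme).2
      (Integrable.fintype_prod fun i => integrable_exp_neg_mul_sq (hw i))
  · refine (hmp.integral_comp hme (fun z : Fin n → ℝ => ∏ i, Real.exp (-w i * z i ^ 2))).trans ?_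
    rw [integral_fintype_prod_volume_eq_prod (fun i (x : ℝ) => Real.exp (-w i * x ^ 2))]
    simp_rw [integral_gaussian]

theorem exists_orthonormalBasis_norm_smul {n : ℕ} [NeZero n] (x : Space n) :
    ∃ b : OrthonormalBasis (Fin n) ℝ (Space n), ‖x‖ • b 0 = x := by
  obtain ⟨e, he, hx⟩ : ∃ e : Space n, ‖e‖ = 1 ∧ ‖x‖ • e = x := by
    by_cases hx : x = 0
    · exact ⟨EuclideanSpace.single 0 1, by simp, by simp [hx]⟩
    · have : ‖x‖ ≠ 0 := norm_ne_zero_iff.2 hx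
      exact ⟨‖x‖⁻¹ • x, by rw [norm_smul, norm_inv, norm_norm, inv_mul_cancel₀ this],
        by rw [smul_smul, mul_inv_cancel₀ this, one_smul]⟩
  obtain ⟨b, hb⟩ := Orthonormal.exists_orthonormalBasis_extension_of_card_eq (𝕜 := ℝ)
    (E := Space n) (ι := Fin n) (by simp) (v := fun _ => e) (s := {0})
    ⟨fun _ => he, fun i j hij => absurd (Subsingleton.elim i j) hij⟩
  exact ⟨b, by rw [hb 0 rfl, hx]⟩

/-- Laplace's method by a Gaussian majorant: on the annulus the inner product of x with y/|y| is at
most |x| (1 - q/8), where q is the squared length of the part of y orthogonal to x. Each of the n -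
1 orthogonal directions then contributes a factor (1+|x|)^(-1/2). -/
theorem waveAverage_le {n : ℕ} (hn : 1 ≤ n) : ∃ C : ℝ, 0 < C ∧ ∀ x : Space n,
    waveAverage x ≤ C * (Real.exp ‖x‖ * (1 + ‖x‖) ^ (-((n - 1 : ℝ) / 2))) := by
  have : NeZero n := ⟨by omega⟩
  refine ⟨Real.exp (9 / 2) * (Real.sqrt Real.pi * Real.sqrt (8 * Real.pi) ^ (n - 1)), by positivity,
    fun x => ?_⟩
  obtain ⟨b, hb⟩ := exists_orthonormalBasis_norm_smul x
  set r := ‖x‖ with hr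
  have hr0 : 0 ≤ r := norm_nonneg x
  -- The weight 1 along x and the 1 in 1 + r keep the Gaussian integrable, also for r = 0. They cost
  -- z² + q/8 ≤ 4 on the annulus, covered by the 9/2.
  set w : Fin n → ℝ := fun i => if i = 0 then 1 else (1 + r) / 8 with hw
  have hwpos : ∀ i, 0 < w i := fun i => by simp only [hw]; split_ifs <;> positivity
  obtain ⟨hint, hval⟩ := integrable_and_integral_gaussian_orthonormal b hwpos
  have hpt : ∀ y ∈ Metric.closedBall (0 : Space n) 2 \ Metric.ball 0 1,
      Real.exp (inner ℝ x (‖y‖⁻¹ • y)) ≤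
        Real.exp (r + 9 / 2) * Real.exp (-∑ i, w i * inner ℝ (b i) y ^ 2) := by
    intro y hy
    have h1 : 1 ≤ ‖y‖ := by simpa using hy.2
    have h2 : ‖y‖ ≤ 2 := by simpa using hy.1
    rw [← Real.exp_add]
    apply Real.exp_le_exp.2
    have hsum := b.sum_sq_inner_right y
    rw [← Finset.add_sum_erase _ _ (Finset.mem_univ 0)] at hsum ⊢
    have e1 : ∑ i ∈ Finset.univ.erase 0, w i * inner ℝ (b i) y ^ 2
        = (1 + r) / 8 * ∑ i ∈ Finset.univ.erase 0, inner ℝ (b i) y ^ 2 := by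
      rw [Finset.mul_sum]
      refine Finset.sum_congr rfl fun i hi => ?_
      simp only [hw, if_neg (Finset.ne_of_mem_erase hi)]
    rw [e1]
    set q := ∑ i ∈ Finset.univ.erase 0, inner ℝ (b i) y ^ 2
    set z := inner ℝ (b 0) y
    have hq0 : 0 ≤ q := Finset.sum_nonneg fun i _ => sq_nonneg _
    have e2 : inner ℝ x (‖y‖⁻¹ • y) = r * (z / ‖y‖) := by
      rw [← hb, inner_smul_left, inner_smul_right]
      simp only [conj_trivial]
      rw [div_eq_inv_mul]
    rw [e2, show w 0 = 1 by simp [hw]]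
    have h3 : z / ‖y‖ ≤ 1 - q / 8 := by
      rw [div_le_iff₀ (by linarith)]
      -- `z ≤ ‖y‖ - q / (2 ‖y‖)`
      have h4 : z ^ 2 + q = ‖y‖ ^ 2 := hsum
      have h5 : z * ‖y‖ ≤ ‖y‖ ^ 2 - q / 2 := by nlinarith [sq_nonneg (z - ‖y‖)]
      have h6 : q * ‖y‖ ^ 2 ≤ q * 4 := by
        apply mul_le_mul_of_nonneg_left _ hq0
        nlinarith
      have h7 : 0 < ‖y‖ := by linarith
      have h8 : z * ‖y‖ ≤ (1 - q / 8) * ‖y‖ * ‖y‖ := by nlinarith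
      exact le_of_mul_le_mul_right h8 h7
    have h9 : r * (z / ‖y‖) ≤ r * (1 - q / 8) := by gcongr
    have h10 : z ^ 2 + q ≤ 4 := by rw [hsum]; nlinarith
    nlinarith [sq_nonneg z]
  have hle : waveAverage x ≤ Real.exp (r + 9 / 2) * ∏ i, Real.sqrt (Real.pi / w i) := by
    rw [← hval, ← integral_const_mul]
    refine (integral_mono_of_nonneg (Eventually.of_forall fun _ => (Real.exp_pos _).le)
      (hint.const_mul _).integrableOn ?_).trans
      (setIntegral_le_integral (hint.const_mul _) (Eventually.of_forall fun _ => by positivity))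
    exact (ae_restrict_iff' (measurableSet_annulus n)).2 (Eventually.of_forall hpt)
  refine hle.trans_eq ?_
  rw [← Finset.mul_prod_erase _ _ (Finset.mem_univ (0 : Fin n))]
  have e3 : ∏ i ∈ Finset.univ.erase (0 : Fin n), Real.sqrt (Real.pi / w i)
      = Real.sqrt (8 * Real.pi) ^ (n - 1) * (1 + r) ^ (-((n - 1 : ℝ) / 2)) := by
    have : ∀ i ∈ Finset.univ.erase (0 : Fin n), Real.sqrt (Real.pi / w i)
        = Real.sqrt (8 * Real.pi) * (1 + r) ^ (-(1 / 2) : ℝ) := by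
      intro i hi
      simp only [hw, if_neg (Finset.ne_of_mem_erase hi)]
      rw [show Real.pi / ((1 + r) / 8) = 8 * Real.pi / (1 + r) by field_simp,
        Real.sqrt_div (by positivity), Real.rpow_neg (by positivity), ← Real.sqrt_eq_rpow]
      rfl
    rw [Finset.prod_congr rfl this, Finset.prod_const, Finset.card_erase_of_mem (Finset.mem_univ _),
      Finset.card_univ, Fintype.card_fin, mul_pow, ← Real.rpow_natCast (_ ^ _),
      ← Real.rpow_mul (by positivity), Nat.cast_sub hn]
    congr 2
    push_cast; ring
  rw [e3, show w 0 = 1 by simp [hw], div_one, Real.exp_add]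
  ring

/-- Polynomial weights are dominated by exponentials. -/
theorem one_add_rpow_le_exp {s q : ℝ} (hs : 0 < s) (hq : 0 < q) :
    ∃ K : ℝ, 0 < K ∧ ∀ η : ℝ, 0 ≤ η → (1 + η) ^ s ≤ K * Real.exp (q * η) := by
  refine ⟨max 1 (s / q) ^ s, by positivity, fun η hη => ?_⟩
  have h1 : 1 + η ≤ max 1 (s / q) * Real.exp (q / s * η) := by
    calc 1 + η ≤ max 1 (s / q) * (q / s * η + 1) := by
          have h2 : s / q * (q / s * η) = η := by field_simp
          have h3 : 0 ≤ q / s * η := by positivity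
          nlinarith [le_max_left 1 (s / q), mul_le_mul_of_nonneg_right (le_max_right 1 (s / q)) h3]
      _ ≤ _ := by
          gcongr
          exact Real.add_one_le_exp _
  calc (1 + η) ^ s ≤ (max 1 (s / q) * Real.exp (q / s * η)) ^ s := by gcongr
    _ = _ := by
      rw [Real.mul_rpow (by positivity) (by positivity), ← Real.exp_mul]
      congr 2; field_simp

/-- `(1 + r) ^ β ≤ C (1 + ρ) ^ β` when `ρ` and `r` are comparable. -/
theorem rpow_le_of_ratio {β x y : ℝ} {M : ℝ} (hx : 0 < x) (hy : 0 < y) (h1 : x ≤ M * y)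
    (h2 : y ≤ M * x) : x ^ β ≤ M ^ |β| * y ^ β := by
  have hM : 0 < M := pos_of_mul_pos_left (hx.trans_le h1) hy.le
  rcases le_total 0 β with hβ | hβ
  · rw [abs_of_nonneg hβ, ← Real.mul_rpow hM.le hy.le]
    exact Real.rpow_le_rpow hx.le h1 hβ
  · rw [abs_of_nonpos hβ, Real.rpow_neg hM.le, ← Real.inv_rpow hM.le,
      ← Real.mul_rpow (by positivity) hy.le]
    refine Real.rpow_le_rpow_of_nonpos (by positivity) ?_ hβ
    rwa [inv_mul_le_iff₀ hM]

/-- In polar coordinates the integrand is at most of order e^{qr} (1+r)^β, with its mass near r = ρ.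
Replacing (1+r)^β by (1+ρ)^β costs a power of 1 + ρ - r, paid for by half of the exponential; the
other half is integrated. -/
theorem setIntegral_waveAverage_rpow_le {n : ℕ} (hn : 1 ≤ n) {q : ℝ} (hq : 0 < q) :
    ∃ C : ℝ, 0 < C ∧ ∀ ρ : ℝ, 0 ≤ ρ →
      ∫ x in Metric.closedBall (0 : Space n) ρ, waveAverage x ^ q ≤
        C * ((1 + ρ) ^ ((n - 1 : ℝ) * (1 - q / 2)) * Real.exp (q * ρ)) := by
  have : NeZero n := ⟨by omega⟩
  obtain ⟨C₀, hC₀, hle⟩ := waveAverage_le hn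
  set β := (n - 1 : ℝ) * (1 - q / 2) with hβ
  -- The + 1 keeps the exponent positive when β = 0.
  obtain ⟨K, hK, hKle⟩ := one_add_rpow_le_exp (s := |β| + 1) (q := q / 2) (by positivity)
    (by positivity)
  set V := (n : ℝ) * volume.real (Metric.ball (0 : Space n) 1) with hV
  have hV0 : 0 ≤ V := by positivity
  refine ⟨C₀ ^ q * (V * (K * (2 / q))) + 1, by positivity, fun ρ hρ => ?_⟩
  set φ : ℝ → ℝ := (Iic ρ).indicator fun r =>
    C₀ ^ q * (Real.exp (q * r) * (1 + r) ^ (-((n - 1 : ℝ) / 2) * q)) with hφ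
  have hbound : ∀ x : Space n, waveAverage x ^ q ≤
      C₀ ^ q * (Real.exp (q * ‖x‖) * (1 + ‖x‖) ^ (-((n - 1 : ℝ) / 2) * q)) := by
    intro x
    have := Real.rpow_le_rpow (waveAverage_nonneg x) (hle x) hq.le
    rwa [Real.mul_rpow hC₀.le (by positivity), Real.mul_rpow (Real.exp_pos _).le (by positivity),
      ← Real.exp_mul, ← Real.rpow_mul (by positivity), mul_comm ‖x‖ q] at this
  have hcont : Continuous fun x : Space n =>
      C₀ ^ q * (Real.exp (q * ‖x‖) * (1 + ‖x‖) ^ (-((n - 1 : ℝ) / 2) * q)) := by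
    refine continuous_const.mul ((by fun_prop : Continuous fun x : Space n =>
      Real.exp (q * ‖x‖)).mul (Continuous.rpow_const (by fun_prop) fun x => Or.inl ?_))
    positivity
  have h1 : ∫ x in Metric.closedBall (0 : Space n) ρ, waveAverage x ^ q
      ≤ ∫ x : Space n, φ ‖x‖ := by
    have e : ∫ x : Space n, φ ‖x‖ = ∫ x in Metric.closedBall (0 : Space n) ρ,
        C₀ ^ q * (Real.exp (q * ‖x‖) * (1 + ‖x‖) ^ (-((n - 1 : ℝ) / 2) * q)) := by
      rw [← integral_indicator measurableSet_closedBall]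
      congr 1
      ext x
      simp only [hφ, indicator, mem_Iic, Metric.mem_closedBall, dist_zero_right]
    rw [e]
    exact integral_mono_of_nonneg
      (Eventually.of_forall fun x => Real.rpow_nonneg (waveAverage_nonneg x) _)
      (hcont.continuousOn.integrableOn_compact (isCompact_closedBall _ _))
      (Eventually.of_forall hbound)
  have h2 : ∫ x : Space n, φ ‖x‖ = V * ∫ y in Ioi (0 : ℝ), y ^ (n - 1) * φ y := by
    rw [integral_fun_norm_addHaar]
    simp only [smul_eq_mul, nsmul_eq_mul, finrank_euclideanSpace, Fintype.card_fin]
    rw [hV]; ring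
  have h3 : ∫ y in Ioi (0 : ℝ), y ^ (n - 1) * φ y ≤
      ∫ y in Iic ρ, C₀ ^ q * ((1 + ρ) ^ β * (K * Real.exp (q / 2 * ρ))) * Real.exp (q / 2 * y) := by
    rw [← integral_indicator measurableSet_Ioi, ← integral_indicator measurableSet_Iic]
    refine integral_mono_of_nonneg (Eventually.of_forall fun y => ?_)
      ((integrable_indicator_iff measurableSet_Iic).2
        ((integrableOn_exp_mul_Iic (by positivity) ρ).const_mul _))
      (Eventually.of_forall fun y => ?_)
    · simp only [indicator, hφ, mem_Ioi, mem_Iic, Pi.zero_apply]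
      split_ifs <;> positivity
    · simp only [indicator, hφ, mem_Ioi, mem_Iic]
      split_ifs with h0 hρ'
      · have hy1 : y ^ (n - 1) ≤ (1 + y) ^ ((n - 1 : ℕ) : ℝ) := by
          rw [Real.rpow_natCast]; gcongr; linarith
        have hy2 : (1 + y) ^ β ≤ (1 + (ρ - y)) ^ |β| * (1 + ρ) ^ β :=
          rpow_le_of_ratio (by positivity) (by positivity) (by nlinarith) (by nlinarith)
        have hy3 : (1 + (ρ - y)) ^ |β| ≤ K * Real.exp (q / 2 * (ρ - y)) :=
          (Real.rpow_le_rpow_of_exponent_le (by linarith) (by linarith)).trans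
            (hKle _ (by linarith))
        calc y ^ (n - 1) * (C₀ ^ q * (Real.exp (q * y) * (1 + y) ^ (-((n - 1 : ℝ) / 2) * q)))
            ≤ (1 + y) ^ ((n - 1 : ℕ) : ℝ) *
              (C₀ ^ q * (Real.exp (q * y) * (1 + y) ^ (-((n - 1 : ℝ) / 2) * q))) := by gcongr
          _ = C₀ ^ q * (Real.exp (q * y) * (1 + y) ^ β) := by
            have : (1 + y) ^ β = (1 + y) ^ ((n - 1 : ℕ) : ℝ)
                * (1 + y) ^ (-((n - 1 : ℝ) / 2) * q) := by
              rw [← Real.rpow_add (by positivity), hβ, Nat.cast_sub hn]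
              congr 1; push_cast; ring
            rw [this]; ring
          _ ≤ C₀ ^ q * (Real.exp (q * y) *
              (K * Real.exp (q / 2 * (ρ - y)) * (1 + ρ) ^ β)) := by
            gcongr
            exact hy2.trans (by gcongr)
          _ = C₀ ^ q * ((1 + ρ) ^ β * K * (Real.exp (q * y) * Real.exp (q / 2 * (ρ - y)))) := by
            ring
          _ = C₀ ^ q * ((1 + ρ) ^ β * K * (Real.exp (q / 2 * ρ) * Real.exp (q / 2 * y))) := by
            rw [← Real.exp_add, ← Real.exp_add]; ring_nf
          _ = _ := by ring
      · simp
      · positivity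
      · exact le_rfl
  rw [integral_const_mul, integral_exp_mul_Iic (by positivity)] at h3
  calc _ ≤ V * (C₀ ^ q * ((1 + ρ) ^ β * (K * Real.exp (q / 2 * ρ))) *
        (Real.exp (q / 2 * ρ) / (q / 2))) := by
        refine h1.trans (h2.le.trans ?_)
        gcongr
    _ = C₀ ^ q * (V * (K * (2 / q))) *
        ((1 + ρ) ^ β * (Real.exp (q / 2 * ρ) * Real.exp (q / 2 * ρ))) := by
        field_simp
    _ = C₀ ^ q * (V * (K * (2 / q))) * ((1 + ρ) ^ β * Real.exp (q * ρ)) := by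
        rw [← Real.exp_add]; congr 3; ring
    _ ≤ _ := by gcongr; linarith

/-! ### Truncated plane waves -/

/-- A smooth cutoff equal to `1` on the ball of radius `ρ + 1`. -/
def cutoff (n : ℕ) (ρ : ℝ) (hρ : 0 ≤ ρ) : ContDiffBump (0 : Space n) :=
  ⟨ρ + 1, ρ + 2, by linarith, by linarith⟩

/-- The plane wave `e ^ ⟪x, ξ⟫` cut off smoothly outside the ball of radius `ρ + 1`. -/
noncomputable def planeWave {n : ℕ} (ρ : ℝ) (hρ : 0 ≤ ρ) (ξ x : Space n) : ℝ :=
  cutoff n ρ hρ x * Real.exp (inner ℝ x ξ)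

section planeWave

variable {n : ℕ} {ρ : ℝ} (hρ : 0 ≤ ρ) (ξ : Space n)

theorem contDiff_planeWave : ContDiff ℝ ∞ (planeWave ρ hρ ξ) :=
  (cutoff n ρ hρ).contDiff.mul (contDiff_id.inner ℝ contDiff_const).exp

theorem hasCompactSupport_planeWave : HasCompactSupport (planeWave ρ hρ ξ) :=
  (cutoff n ρ hρ).hasCompactSupport.mul_right

theorem planeWave_nonneg (x : Space n) : 0 ≤ planeWave ρ hρ ξ x :=
  mul_nonneg (cutoff n ρ hρ).nonneg (Real.exp_pos _).le

theorem planeWave_eq {x : Space n} (hx : ‖x‖ ≤ ρ + 1) :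
    planeWave ρ hρ ξ x = Real.exp (inner ℝ x ξ) := by
  rw [planeWave, (cutoff n ρ hρ).one_of_mem_closedBall (by simpa [cutoff] using hx), one_mul]

theorem planeWave_eventuallyEq {x : Space n} (hx : ‖x‖ < ρ + 1) :
    planeWave ρ hρ ξ =ᶠ[𝓝 x] fun x => Real.exp (inner ℝ x ξ) := by
  filter_upwards [continuous_norm.continuousAt.eventually_lt continuousAt_const hx] with y hy
  exact planeWave_eq hρ ξ hy.le

/-- The exponential is an eigenfunction of the Laplacian. The spare unit of radius makes the cutoff
equal to 1 near every point of the closed ball of radius ρ, so derivatives do not see it there. -/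
theorem sum_fderiv_fderiv_planeWave {x : Space n} (hx : ‖x‖ < ρ + 1) :
    ∑ i, fderiv ℝ (fun y => fderiv ℝ (planeWave ρ hρ ξ) y (EuclideanSpace.basisFun (Fin n) ℝ i)) x
      (EuclideanSpace.basisFun (Fin n) ℝ i) = ‖ξ‖ ^ 2 * planeWave ρ hρ ξ x := by
  have hexp (y : Space n) : HasFDerivAt (fun x => Real.exp (inner ℝ x ξ))
      (Real.exp (inner ℝ y ξ) • innerSL ℝ ξ) y := by
    have h : HasFDerivAt (fun x : Space n => inner ℝ x ξ) (innerSL ℝ ξ) y := by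
      have := (innerSL ℝ ξ).hasFDerivAt (x := y)
      refine this.congr_of_eventuallyEq (Eventually.of_forall fun z => ?_)
      simp [real_inner_comm]
    exact h.exp
  have hfd (e y : Space n) (hy : ‖y‖ < ρ + 1) : fderiv ℝ (planeWave ρ hρ ξ) y e
      = inner ℝ ξ e * Real.exp (inner ℝ y ξ) := by
    rw [(planeWave_eventuallyEq hρ ξ hy).fderiv_eq, (hexp y).fderiv]
    simp [mul_comm]
  have hfd2 (e : Space n) : fderiv ℝ (fun y => fderiv ℝ (planeWave ρ hρ ξ) y e) x e
      = inner ℝ e ξ ^ 2 * Real.exp (inner ℝ x ξ) := by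
    have : (fun y => fderiv ℝ (planeWave ρ hρ ξ) y e) =ᶠ[𝓝 x]
        fun y => inner ℝ ξ e * Real.exp (inner ℝ y ξ) := by
      filter_upwards [continuous_norm.continuousAt.eventually_lt continuousAt_const hx] with y hy
      exact hfd e y hy
    rw [this.fderiv_eq, ((hexp x).const_mul (inner ℝ ξ e)).fderiv]
    simp [real_inner_comm ξ e]
    ring
  simp_rw [hfd2]
  rw [← Finset.sum_mul, (EuclideanSpace.basisFun (Fin n) ℝ).sum_sq_inner_right,
    planeWave_eq hρ ξ hx.le]

end planeWave

/-- Integration by parts against a smooth compactly supported function. -/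
theorem integral_inner_gradient {n : ℕ} {w : Space n → ℝ} {G : Space n → Space n}
    (hw : MemLp w 2) (hG : MemLp G 2) (hwG : IsWeakGradient w G) {ψ : Space n → ℝ}
    (hψ : ContDiff ℝ ∞ ψ) (hψc : HasCompactSupport ψ) :
    ∫ x, inner ℝ (G x) (gradient ψ x) = - ∫ x, w x *
      ∑ i, fderiv ℝ (fun y => fderiv ℝ ψ y (EuclideanSpace.basisFun (Fin n) ℝ i)) x
        (EuclideanSpace.basisFun (Fin n) ℝ i) := by
  set b := EuclideanSpace.basisFun (Fin n) ℝ with hb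
  have hψ1 (i : Fin n) : ContDiff ℝ ∞ fun y => fderiv ℝ ψ y (b i) :=
    (hψ.fderiv_right (by norm_cast)).clm_apply contDiff_const
  have hψ1c (i : Fin n) : HasCompactSupport fun y => fderiv ℝ ψ y (b i) :=
    hψc.fderiv_apply ℝ (b i)
  have hψ2 (i : Fin n) : Continuous fun x => fderiv ℝ (fun y => fderiv ℝ ψ y (b i)) x (b i) :=
    (((hψ1 i).fderiv_right (m := ∞) (by norm_cast)).clm_apply contDiff_const).continuous
  have hψ2c (i : Fin n) : HasCompactSupport
      fun x => fderiv ℝ (fun y => fderiv ℝ ψ y (b i)) x (b i) :=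
    (hψ1c i).fderiv_apply ℝ (b i)
  have e1 (x : Space n) : inner ℝ (G x) (gradient ψ x)
      = ∑ i, inner ℝ (G x) (b i) * fderiv ℝ ψ x (b i) := by
    rw [← b.sum_inner_mul_inner]
    refine Finset.sum_congr rfl fun i _ => ?_
    rw [real_inner_comm (gradient ψ x) (b i), gradient, InnerProductSpace.toDual_symm_apply]
  have hGi (i : Fin n) : Integrable fun x => inner ℝ (G x) (b i) * fderiv ℝ ψ x (b i) :=
    (hG.inner_const (b i)).integrable_mul
      ((hψ1 i).continuous.memLp_of_hasCompactSupport (hψ1c i) (p := 2))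
  have hwi (i : Fin n) : Integrable
      fun x => w x * fderiv ℝ (fun y => fderiv ℝ ψ y (b i)) x (b i) :=
    hw.integrable_mul ((hψ2 i).memLp_of_hasCompactSupport (hψ2c i) (p := 2))
  simp_rw [e1, Finset.mul_sum]
  rw [integral_finsetSum _ fun i _ => hGi i, integral_finsetSum _ fun i _ => hwi i,
    ← Finset.sum_neg_distrib]
  refine Finset.sum_congr rfl fun i _ => ?_
  rw [hwG _ (hψ1 i) (hψ1c i) (b i), neg_neg]

theorem integral_inner_gradient_planeWave {n : ℕ} {ρ : ℝ} (hρ : 0 ≤ ρ) (ξ : Space n)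
    {w : Space n → ℝ} {G : Space n → Space n} (hw : MemLp w 2) (hG : MemLp G 2)
    (hwG : IsWeakGradient w G) (hsupp : ∀ᵐ x, ρ < ‖x‖ → w x = 0) :
    ∫ x, inner ℝ (G x) (gradient (planeWave ρ hρ ξ) x)
      = -(‖ξ‖ ^ 2 * ∫ x, w x * planeWave ρ hρ ξ x) := by
  rw [integral_inner_gradient hw hG hwG (contDiff_planeWave hρ ξ)
    (hasCompactSupport_planeWave hρ ξ), ← integral_const_mul]
  congr 1
  refine integral_congr_ae ?_
  filter_upwards [hsupp] with x hx
  rcases lt_or_ge ρ ‖x‖ with h | h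
  · simp [hx h]
  · rw [sum_fderiv_fderiv_planeWave hρ ξ (by linarith)]
    ring

/-! ### Continuity of weighted `L^p` norms -/

theorem MemLp.mul_of_tsupport {n : ℕ} {ψ w : Space n → ℝ} {P : ℝ≥0∞} (hψ : Continuous ψ)
    (hψc : HasCompactSupport ψ) (hw : MemLp w P (volume.restrict (tsupport ψ))) :
    MemLp (fun x => ψ x * w x) P := by
  obtain ⟨M, hM⟩ := hψ.bounded_above_of_compact_support hψc
  have h1 : MemLp (fun x => ψ x * w x) P (volume.restrict (tsupport ψ)) :=
    hw.of_le_mul (c := M) (hψ.aestronglyMeasurable.mul hw.1)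
      (Eventually.of_forall fun x => by rw [norm_mul]; gcongr; exact hM x)
  have h2 : (tsupport ψ).indicator (fun x => ψ x * w x) = fun x => ψ x * w x := by
    rw [indicator_eq_self]
    exact (Function.support_mul_subset_left _ _).trans (subset_tsupport ψ)
  rw [← h2]
  exact (memLp_indicator_iff_restrict (isClosed_tsupport ψ).measurableSet).2 h1

theorem eLpNorm_mul_le_of_tsupport {n : ℕ} {ψ : Space n → ℝ} (P : ℝ≥0∞) (hψ : Continuous ψ)
    (hψc : HasCompactSupport ψ) : ∃ M : ℝ, ∀ w : Space n → ℝ,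
      eLpNorm (fun x => ψ x * w x) P volume ≤
        ENNReal.ofReal M * eLpNorm w P (volume.restrict (tsupport ψ)) := by
  obtain ⟨M, hM⟩ := hψ.bounded_above_of_compact_support hψc
  refine ⟨M, fun w => ?_⟩
  have h2 : (tsupport ψ).indicator (fun x => ψ x * w x) = fun x => ψ x * w x := by
    rw [indicator_eq_self]
    exact (Function.support_mul_subset_left _ _).trans (subset_tsupport ψ)
  rw [← h2, eLpNorm_indicator_eq_eLpNorm_restrict (isClosed_tsupport ψ).measurableSet]
  exact eLpNorm_le_mul_eLpNorm_of_ae_le_mul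
    (Eventually.of_forall fun x => by rw [norm_mul]; gcongr; exact hM x) P

/-- The integral is the p-th power of the L^p norm of ψ^(1/p) u, and norms are continuous. This
continuity of N is what makes the moments twice differentiable at positive times. -/
theorem ContinuousLpLoc.continuousAt_integral {n : ℕ} {p T : ℝ} (hp : 1 < p)
    {u : ℝ → Space n → ℝ} (hu : ContinuousLpLoc p T u) {ψ : Space n → ℝ} (hψ : Continuous ψ)
    (hψc : HasCompactSupport ψ) (hψ0 : ∀ x, 0 ≤ ψ x) {t : ℝ} (ht : t ∈ Ioo 0 T) :
    ContinuousAt (fun s => ∫ x, |u s x| ^ p * ψ x) t := by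
  have hp0 : 0 < p := by linarith
  set P := ENNReal.ofReal p with hP
  have hP1 : 1 ≤ P := by
    rw [hP, ← ENNReal.ofReal_one]
    exact ENNReal.ofReal_le_ofReal hp.le
  set η : Space n → ℝ := fun x => ψ x ^ (1 / p) with hη
  have hηcont : Continuous η := hψ.rpow_const fun x => Or.inr (by positivity)
  have hηc : HasCompactSupport η := hψc.comp_left (g := fun r : ℝ => r ^ (1 / p))
    (Real.zero_rpow (by positivity))
  have hmem (s : ℝ) (hs : s ∈ Ioo 0 T) : MemLp (fun x => η x * u s x) P :=
    MemLp.mul_of_tsupport hηcont hηc (hu _ hηc s hs).1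
  set E : ℝ → ℝ≥0∞ := fun s => eLpNorm (fun x => η x * u s x) P volume with hE
  have hEt : Tendsto E (𝓝 t) (𝓝 (E t)) := by
    obtain ⟨M, hM⟩ := eLpNorm_mul_le_of_tsupport P hηcont hηc
    set Δ : ℝ → ℝ≥0∞ := fun s => eLpNorm (fun x => η x * (u s - u t) x) P volume with hΔ
    have hΔ0 : Tendsto Δ (𝓝 t) (𝓝 0) := by
      have := ENNReal.Tendsto.const_mul (a := ENNReal.ofReal M) (hu _ hηc t ht).2
        (Or.inr ENNReal.ofReal_ne_top)
      rw [mul_zero] at this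
      exact tendsto_of_tendsto_of_tendsto_of_le_of_le tendsto_const_nhds this
        (fun s => zero_le) fun s => hM _
    have hEtop : E t ≠ ⊤ := (hmem t ht).2.ne
    have hnear : ∀ᶠ s in 𝓝 t, s ∈ Ioo 0 T := Ioo_mem_nhds ht.1 ht.2
    have hlow : Tendsto (fun s => E t - Δ s) (𝓝 t) (𝓝 (E t)) := by
      simpa using ENNReal.Tendsto.sub (tendsto_const_nhds (x := E t)) hΔ0 (Or.inl hEtop)
    have hup : Tendsto (fun s => E t + Δ s) (𝓝 t) (𝓝 (E t)) := by
      simpa using (tendsto_const_nhds (x := E t)).add hΔ0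
    refine tendsto_of_tendsto_of_tendsto_of_le_of_le' hlow hup ?_ ?_
    · filter_upwards [hnear] with s hs
      rw [tsub_le_iff_right]
      have hd : MemLp (fun x => η x * (u s - u t) x) P := by
        have := (hmem s hs).sub (hmem t ht)
        refine this.congr_norm ?_ (Eventually.of_forall fun x => ?_)
        · exact this.1.congr (Eventually.of_forall fun x => by simp [mul_sub])
        · simp [mul_sub]
      have e : (fun x => η x * u t x) = (fun x => η x * u s x) - fun x => η x * (u s - u t) x := by
        ext x; simp; ring
      calc E t = eLpNorm ((fun x => η x * u s x) - fun x => η x * (u s - u t) x) P volume := by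
            rw [hE]; simp only []; rw [← e]
        _ ≤ _ := eLpNorm_sub_le (hmem s hs).1 hd.1 hP1
    · filter_upwards [hnear] with s hs
      have hd : MemLp (fun x => η x * (u s - u t) x) P := by
        have := (hmem s hs).sub (hmem t ht)
        refine this.congr_norm ?_ (Eventually.of_forall fun x => ?_)
        · exact this.1.congr (Eventually.of_forall fun x => by simp [mul_sub])
        · simp [mul_sub]
      have e : (fun x => η x * u s x) = (fun x => η x * u t x) + fun x => η x * (u s - u t) x := by
        ext x; simp; ring
      calc E s = eLpNorm ((fun x => η x * u t x) + fun x => η x * (u s - u t) x) P volume := by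
            rw [hE]; simp only []; rw [← e]
        _ ≤ _ := eLpNorm_add_le (hmem t ht).1 hd.1 hP1
  have hval (s : ℝ) (hs : s ∈ Ioo 0 T) : ∫ x, |u s x| ^ p * ψ x = (E s).toReal ^ p := by
    have h1 := (hmem s hs).eLpNorm_eq_integral_rpow_norm (by simp [hP, hp0]) (by simp [hP])
    have hPr : P.toReal = p := ENNReal.toReal_ofReal hp0.le
    rw [hPr] at h1
    have h0 : 0 ≤ ∫ x, ‖η x * u s x‖ ^ p :=
      integral_nonneg fun x => Real.rpow_nonneg (norm_nonneg _) _
    simp only [hE]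
    rw [h1, ENNReal.toReal_ofReal (by positivity), ← Real.rpow_mul h0, inv_mul_cancel₀ hp0.ne',
      Real.rpow_one]
    refine integral_congr_ae (Eventually.of_forall fun x => ?_)
    have hη0 : 0 ≤ η x := Real.rpow_nonneg (hψ0 x) _
    simp only [norm_mul, Real.norm_eq_abs, abs_of_nonneg hη0]
    rw [Real.mul_rpow hη0 (abs_nonneg _), hη, ← Real.rpow_mul (hψ0 x),
      one_div_mul_cancel hp0.ne', Real.rpow_one, mul_comm]
  have hcont : ContinuousAt (fun s => (E s).toReal ^ p) t :=
    ((ENNReal.tendsto_toReal (hmem t ht).2.ne).comp hEt).rpow_const (Or.inr hp0.le)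
  refine hcont.congr ?_
  filter_upwards [Ioo_mem_nhds ht.1 ht.2] with s hs
  exact (hval s hs).symm

/-! ### Moments of energy solutions -/

/-- Pairing in `L²` with a continuous compactly supported function, as a continuous functional. -/
theorem exists_continuousLinearMap_pairing {n : ℕ} {ψ : Space n → ℝ} (hψ : Continuous ψ)
    (hψc : HasCompactSupport ψ) :
    ∃ L : Lp ℝ 2 (volume : Measure (Space n)) →L[ℝ] ℝ, ∀ w, L w = ∫ x, w x * ψ x := by
  have hmem : MemLp ψ 2 := hψ.memLp_of_hasCompactSupport hψc
  refine ⟨innerSL ℝ hmem.toLp, fun w => ?_⟩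
  rw [innerSL_apply_apply, L2.inner_def]
  refine integral_congr_ae ?_
  filter_upwards [hmem.coeFn_toLp] with x hx
  simp [hx]

/-- The product of a spatial test function with a temporal cutoff is a test function. -/
theorem exists_isTestFunction {n : ℕ} {ψ : Space n → ℝ} (hψ : ContDiff ℝ ∞ ψ)
    (hψc : HasCompactSupport ψ) {t T : ℝ} (ht : 0 ≤ t) (htT : t < T) :
    ∃ η : ℝ → ℝ, IsTestFunction T (fun z : Space n × ℝ => ψ z.1 * η z.2) ∧
      ∀ s ∈ Icc 0 t, η s = 1 ∧ deriv η s = 0 := by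
  -- The radii divide (t, T) into thirds: η is 1 near [0, t] and its support stays below T.
  set η : ContDiffBump (0 : ℝ) := ⟨(2 * t + T) / 3, (t + 2 * T) / 3, by linarith, by linarith⟩
    with hη
  have hsupp : tsupport (fun z : Space n × ℝ => ψ z.1 * η z.2) ⊆ tsupport ψ ×ˢ tsupport η := by
    refine closure_minimal (fun z hz => ?_) ((isClosed_tsupport _).prod (isClosed_tsupport _))
    have hz' : ψ z.1 * η z.2 ≠ 0 := hz
    exact ⟨subset_tsupport _ (left_ne_zero_of_mul hz'),
      subset_tsupport _ (right_ne_zero_of_mul hz')⟩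
  refine ⟨η, ⟨(hψ.comp contDiff_fst).mul (η.contDiff.comp contDiff_snd), ?_, ?_⟩, ?_⟩
  · exact (hψc.isCompact.prod η.hasCompactSupport.isCompact).of_isClosed_subset
      (isClosed_tsupport _) hsupp
  · intro z hz
    have h1 := (hsupp hz).2
    rw [η.tsupport_eq, Metric.mem_closedBall, dist_zero_right] at h1
    have h2 := (le_abs_self _).trans h1
    have h3 : η.rOut = (t + 2 * T) / 3 := rfl
    linarith
  · intro s hs
    have hmem : s ∈ Metric.ball (0 : ℝ) η.rIn := by
      rw [Metric.mem_ball, dist_zero_right, Real.norm_eq_abs, abs_of_nonneg hs.1]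
      have h3 : η.rIn = (2 * t + T) / 3 := rfl
      linarith [hs.2]
    have hev := η.eventuallyEq_one_of_mem_ball hmem
    exact ⟨hev.eq_of_nhds, by rw [hev.deriv_eq]; simp⟩

/-- The moments of an energy solution against a truncated plane wave solve an ordinary
differential equation. -/
theorem IsEnergySolution.momentSystem {n : ℕ} {μ₁ μ₂ p ε : ℝ} (hp : 1 < p) {f g : Space n → ℝ}
    {T R ρ : ℝ} (hT : 0 < T) (hρ : 0 ≤ ρ) (hTR : T + R ≤ ρ)
    {u : ℝ → Lp ℝ 2 (volume : Measure (Space n))}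
    (hu : IsEnergySolution n μ₁ μ₂ p ε f g T u) (hsupp : SupportedInCone R T u) :
    ContinuousLpLoc p T (fun t => u t) ∧ ∀ ξ : Space n, ∃ B : ℝ → ℝ,
      MomentSystem μ₁ μ₂ (‖ξ‖ ^ 2) T (fun t => ∫ x, u t x * planeWave ρ hρ ξ x) B
        (fun t => ∫ x, |u t x| ^ p * planeWave ρ hρ ξ x) ∧
      ∫ x, u 0 x * planeWave ρ hρ ξ x = ε * ∫ x, f x * planeWave ρ hρ ξ x ∧
      B 0 = ε * ∫ x, g x * planeWave ρ hρ ξ x := by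
  obtain ⟨v, G, huc, -, hwG, huv, hvc, hloc, hu0, hv0, hweak⟩ := hu
  refine ⟨hloc, fun ξ => ?_⟩
  set ψ := planeWave ρ hρ ξ with hψdef
  have hψ : ContDiff ℝ ∞ ψ := contDiff_planeWave hρ ξ
  have hψc : HasCompactSupport ψ := hasCompactSupport_planeWave hρ ξ
  set k := ‖ξ‖ ^ 2
  set A : ℝ → ℝ := fun t => ∫ x, u t x * ψ x with hA
  set B : ℝ → ℝ := fun t => ∫ x, v t x * ψ x with hB
  set N : ℝ → ℝ := fun t => ∫ x, |u t x| ^ p * ψ x with hN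
  obtain ⟨L, hL⟩ := exists_continuousLinearMap_pairing hψ.continuous hψc
  have hAL : A = fun t => L (u t) := funext fun t => (hL _).symm
  have hBL : B = fun t => L (v t) := funext fun t => (hL _).symm
  have hAc : ContinuousOn A (Ico 0 T) := by
    rw [hAL]; exact L.continuous.comp_continuousOn huc
  have hBc : ContinuousOn B (Ico 0 T) := by
    rw [hBL]; exact L.continuous.comp_continuousOn hvc
  have hAd (t : ℝ) (ht : t ∈ Ioo 0 T) : HasDerivAt A (B t) t := by
    rw [hAL, hBL]
    exact L.hasFDerivAt.comp_hasDerivAt t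
      ((huv t (Ioo_subset_Ico_self ht)).hasDerivAt (Ico_mem_nhds ht.1 ht.2))
  have hNc (t : ℝ) (ht : t ∈ Ioo 0 T) : ContinuousAt N t :=
    hloc.continuousAt_integral hp hψ.continuous hψc (planeWave_nonneg hρ ξ) ht
  set c : ℝ → ℝ := fun s => k * A s - μ₁ / (1 + s) * B s - μ₂ / (1 + s) ^ 2 * A s with hc
  have hcoef1 : ContinuousOn (fun s : ℝ => μ₁ / (1 + s)) (Ico 0 T) :=
    ContinuousOn.div (by fun_prop) (by fun_prop) fun s hs => by linarith [hs.1]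
  have hcoef2 : ContinuousOn (fun s : ℝ => μ₂ / (1 + s) ^ 2) (Ico 0 T) :=
    ContinuousOn.div (by fun_prop) (by fun_prop) fun s hs => by
      have : 0 < 1 + s := by linarith [hs.1]
      positivity
  have hcc : ContinuousOn c (Ico 0 T) :=
    ((hAc.const_smul k).sub (hcoef1.mul hBc)).sub (hcoef2.mul hAc)
  -- The weak equation becomes the moment equation integrated once. Near time 0 only integrability
  -- of N is known, so it is differentiated on the open interval.
  have hident (t : ℝ) (ht : t ∈ Ico 0 T) : IntervalIntegrable N volume 0 t ∧
      B t = (ε * ∫ x, g x * ψ x) + (∫ s in (0 : ℝ)..t, c s) + ∫ s in (0 : ℝ)..t, N s := by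
    obtain ⟨η, hφ, hη⟩ := exists_isTestFunction hψ hψc ht.1 ht.2
    obtain ⟨hint, heq⟩ := hweak _ hφ t ht
    have hη0 := (hη 0 ⟨le_rfl, ht.1⟩).1
    have hηt := (hη t ⟨ht.1, le_rfl⟩).1
    have hIcc : uIcc 0 t = Icc 0 t := uIcc_of_le ht.1
    have hsub : Icc 0 t ⊆ Ico 0 T := fun s hs => ⟨hs.1, hs.2.trans_lt ht.2⟩
    have hNη : EqOn (fun s => ∫ x, |u s x| ^ p * (ψ x * η s)) N (uIcc 0 t) := by
      intro s hs
      rw [hIcc] at hs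
      simp only [hN, (hη s hs).1, mul_one]
    have i1 : ∫ s in (0 : ℝ)..t, ∫ x, (- (v s x * deriv (fun r => ψ x * η r) s)
        + inner ℝ (G s x) (gradient (fun y => ψ y * η s) x))
        = ∫ s in (0 : ℝ)..t, -(k * A s) := by
      refine intervalIntegral.integral_congr fun s hs => ?_
      rw [hIcc] at hs
      obtain ⟨h1, h2⟩ := hη s hs
      have e : (fun x => - (v s x * deriv (fun r => ψ x * η r) s)
          + inner ℝ (G s x) (gradient (fun y => ψ y * η s) x))
          = fun x => inner ℝ (G s x) (gradient ψ x) := by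
        ext x
        rw [deriv_const_mul_field, h2, h1]
        simp
      simp only [e]
      refine integral_inner_gradient_planeWave hρ ξ (Lp.memLp _) (Lp.memLp _) (hwG s (hsub hs)) ?_
      filter_upwards [hsupp s (hsub hs)] with x hx hlt
      exact hx (by linarith [hs.2, ht.2])
    have i2 : ∫ s in (0 : ℝ)..t, ∫ x, μ₁ / (1 + s) * v s x * (ψ x * η s)
        = ∫ s in (0 : ℝ)..t, μ₁ / (1 + s) * B s := by
      refine intervalIntegral.integral_congr fun s hs => ?_
      rw [hIcc] at hs
      simp only [hB, (hη s hs).1, mul_one]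
      rw [← integral_const_mul]
      simp only [mul_assoc]
    have i3 : ∫ s in (0 : ℝ)..t, ∫ x, μ₂ / (1 + s) ^ 2 * u s x * (ψ x * η s)
        = ∫ s in (0 : ℝ)..t, μ₂ / (1 + s) ^ 2 * A s := by
      refine intervalIntegral.integral_congr fun s hs => ?_
      rw [hIcc] at hs
      simp only [hA, (hη s hs).1, mul_one]
      rw [← integral_const_mul]
      simp only [mul_assoc]
    have i4 : ∫ x, ε * g x * (ψ x * η 0) = ε * ∫ x, g x * ψ x := by
      rw [hη0, ← integral_const_mul]
      simp only [mul_one, mul_assoc]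
    have i5 : ∫ x, v t x * (ψ x * η t) = B t := by
      simp only [hB, hηt, mul_one]
    have hii {F : ℝ → ℝ} (hF : ContinuousOn F (Ico 0 T)) : IntervalIntegrable F volume 0 t :=
      (hF.mono (hIcc.subset.trans hsub)).intervalIntegrable
    have ic : ∫ s in (0 : ℝ)..t, c s = (∫ s in (0 : ℝ)..t, k * A s)
        - (∫ s in (0 : ℝ)..t, μ₁ / (1 + s) * B s) - ∫ s in (0 : ℝ)..t, μ₂ / (1 + s) ^ 2 * A s := by
      have j1 : ∫ s in (0 : ℝ)..t, (k * A s - μ₁ / (1 + s) * B s)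
          = (∫ s in (0 : ℝ)..t, k * A s) - ∫ s in (0 : ℝ)..t, μ₁ / (1 + s) * B s :=
        intervalIntegral.integral_sub (hii (hAc.const_smul k)) (hii (hcoef1.mul hBc))
      rw [← j1]
      exact intervalIntegral.integral_sub (hii ((hAc.const_smul k).sub (hcoef1.mul hBc)))
        (hii (hcoef2.mul hAc))
    refine ⟨hint.congr_ae ?_, ?_⟩
    · refine (ae_restrict_iff' measurableSet_uIoc).2 (Eventually.of_forall fun s hs => ?_)
      exact hNη (uIoc_subset_uIcc hs)
    · have hNint := intervalIntegral.integral_congr (μ := volume) hNη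
      simp only [] at heq
      rw [i1, i2, i3, i4, i5, hNint, intervalIntegral.integral_neg] at heq
      linarith
  refine ⟨B, ⟨hAc, hBc, hAd, fun t ht => ?_, fun t _ => ?_⟩, ?_, ?_⟩
  · have hmem : Ioo 0 T ∈ 𝓝 t := Ioo_mem_nhds ht.1 ht.2
    have htI := Ioo_subset_Ico_self ht
    have d1 : HasDerivAt (fun t => ∫ s in (0 : ℝ)..t, c s) (c t) t := by
      refine intervalIntegral.integral_hasDerivAt_right ?_ ?_ ?_
      · refine (hcc.mono ?_).intervalIntegrable
        rw [uIcc_of_le ht.1.le]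
        exact fun s hs => ⟨hs.1, hs.2.trans_lt ht.2⟩
      · exact (hcc.mono Ioo_subset_Ico_self).stronglyMeasurableAtFilter isOpen_Ioo t ht
      · exact (hcc.mono Ioo_subset_Ico_self).continuousAt hmem
    have d2 : HasDerivAt (fun t => ∫ s in (0 : ℝ)..t, N s) (N t) t :=
      intervalIntegral.integral_hasDerivAt_right (hident t htI).1
        (ContinuousOn.stronglyMeasurableAtFilter isOpen_Ioo
          (fun s hs => (hNc s hs).continuousWithinAt) t ht) (hNc t ht)
    have d3 := (d1.const_add (ε * ∫ x, g x * ψ x)).add d2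
    refine d3.congr_of_eventuallyEq ?_
    filter_upwards [hmem] with s hs
    exact (hident s (Ioo_subset_Ico_self hs)).2
  · exact integral_nonneg fun x =>
      mul_nonneg (Real.rpow_nonneg (abs_nonneg _) _) (planeWave_nonneg hρ ξ x)
  · rw [← integral_const_mul]
    refine integral_congr_ae ?_
    filter_upwards [hu0] with x hx
    rw [hx, mul_assoc]
  · have := (hident 0 ⟨le_rfl, hT⟩).2
    simpa using this

/-- Hölder's inequality on the support of the solution. -/
theorem rpow_abs_integral_le {n : ℕ} {p q : ℝ} (hpq : p.HolderConjugate q) {ρ r : ℝ} (hρ : 0 ≤ ρ)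
    (hr : r ≤ ρ) {w W : Space n → ℝ}
    (hw : MemLp w (ENNReal.ofReal p) (volume.restrict (Metric.closedBall 0 r)))
    (hsupp : ∀ᵐ x, r < ‖x‖ → w x = 0)
    (hW : MemLp W (ENNReal.ofReal q) (volume.restrict (Metric.closedBall 0 r)))
    (hW0 : ∀ x, 0 ≤ W x) :
    |∫ x, w x * (planeWave ρ hρ 0 x * W x)| ^ p ≤
      (∫ x, |w x| ^ p * planeWave ρ hρ 0 x) *
        (∫ x in Metric.closedBall (0 : Space n) r, W x ^ q) ^ (p - 1) := by
  have hp0 := hpq.pos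
  have hind {F : Space n → ℝ} {H : Space n → ℝ}
      (hFH : ∀ x, planeWave ρ hρ 0 x = 1 → F x = H x) (hF : ∀ x, w x = 0 → F x = 0) :
      ∫ x, F x = ∫ x in Metric.closedBall (0 : Space n) r, H x := by
    rw [← integral_indicator measurableSet_closedBall]
    refine integral_congr_ae ?_
    filter_upwards [hsupp] with x hx
    by_cases h : x ∈ Metric.closedBall (0 : Space n) r
    · rw [indicator_of_mem h]
      have h1 : ‖x‖ ≤ r := by simpa using h
      exact hFH x (by rw [planeWave_eq hρ 0 (by linarith)]; simp)
    · rw [indicator_of_notMem h]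
      exact hF x (hx (by simpa using h))
  have e1 : ∫ x, w x * (planeWave ρ hρ 0 x * W x)
      = ∫ x in Metric.closedBall (0 : Space n) r, w x * W x :=
    hind (fun x hx => by rw [hx, one_mul]) fun x hx => by rw [hx, zero_mul]
  have e2 : ∫ x, |w x| ^ p * planeWave ρ hρ 0 x
      = ∫ x in Metric.closedBall (0 : Space n) r, |w x| ^ p :=
    hind (fun x hx => by rw [hx, mul_one]) fun x hx => by
      rw [hx, abs_zero, Real.zero_rpow hp0.ne', zero_mul]
  rw [e1, e2]
  have hI1 : 0 ≤ ∫ x in Metric.closedBall (0 : Space n) r, |w x| ^ p :=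
    integral_nonneg fun x => Real.rpow_nonneg (abs_nonneg _) _
  have hI2 : 0 ≤ ∫ x in Metric.closedBall (0 : Space n) r, W x ^ q :=
    integral_nonneg fun x => Real.rpow_nonneg (hW0 x) _
  have h1 : |∫ x in Metric.closedBall (0 : Space n) r, w x * W x| ≤
      (∫ x in Metric.closedBall (0 : Space n) r, |w x| ^ p) ^ (1 / p) *
      (∫ x in Metric.closedBall (0 : Space n) r, W x ^ q) ^ (1 / q) := by
    refine (abs_integral_le_integral_abs).trans ?_
    have := integral_mul_norm_le_Lp_mul_Lq hpq hw hW
    simp only [Real.norm_eq_abs, abs_of_nonneg (hW0 _)] at this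
    simpa only [abs_mul, abs_of_nonneg (hW0 _)] using this
  have h2 := Real.rpow_le_rpow (abs_nonneg _) h1 hp0.le
  rw [Real.mul_rpow (by positivity) (by positivity), ← Real.rpow_mul hI1, ← Real.rpow_mul hI2,
    one_div_mul_cancel hp0.ne', Real.rpow_one] at h2
  rwa [show 1 / q * p = p - 1 by
    rw [hpq.conjugate_eq]; have := hpq.sub_one_pos.ne'; field_simp] at h2

/-- Averaging lower bounds for moments against plane waves over directions. -/
theorem le_integral_mul_waveAverage {n : ℕ} {ρ : ℝ} (hρ : 0 ≤ ρ) {w : Space n → ℝ} {m : ℝ}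
    (hw : MemLp w 2) (hm : ∀ ξ : Space n, ‖ξ‖ = 1 → m ≤ ∫ x, w x * planeWave ρ hρ ξ x) :
    volume.real (Metric.closedBall (0 : Space n) 2 \ Metric.ball 0 1) * m ≤
      ∫ x, w x * (planeWave ρ hρ 0 x * waveAverage x) := by
  set S := Metric.closedBall (0 : Space n) 2 \ Metric.ball 0 1 with hS
  have : IsFiniteMeasure (volume.restrict S) :=
    ⟨by rw [Measure.restrict_apply_univ]; exact (volume_annulus_ne_top n).lt_top⟩
  have hpw (ξ x : Space n) : planeWave ρ hρ ξ x = planeWave ρ hρ 0 x * Real.exp (inner ℝ x ξ) := by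
    simp [planeWave]
  have hχ : Integrable fun x => w x * planeWave ρ hρ 0 x :=
    hw.integrable_mul ((contDiff_planeWave hρ 0).continuous.memLp_of_hasCompactSupport
      (hasCompactSupport_planeWave hρ 0) (p := 2))
  have hdir (y : Space n) : ‖‖y‖⁻¹ • y‖ ≤ 1 := by
    rw [norm_smul, norm_inv, norm_norm]
    exact inv_mul_le_one
  have hF : Integrable (fun z : Space n × Space n =>
      w z.1 * (planeWave ρ hρ 0 z.1 * Real.exp (inner ℝ z.1 (‖z.2‖⁻¹ • z.2))))
      (volume.prod (volume.restrict S)) := by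
    have h1 : Integrable (fun z : Space n × Space n => (w z.1 * planeWave ρ hρ 0 z.1) * 1)
        (volume.prod (volume.restrict S)) := hχ.mul_prod (integrable_const (1 : ℝ))
    have hexp : Measurable fun z : Space n × Space n => Real.exp (inner ℝ z.1 (‖z.2‖⁻¹ • z.2)) :=
      Real.measurable_exp.comp
        (measurable_fst.inner ((measurable_direction n).comp measurable_snd))
    refine (h1.norm.const_mul (Real.exp (ρ + 2))).mono' ?_ (Eventually.of_forall fun z => ?_)
    · refine (h1.aestronglyMeasurable.mul hexp.aestronglyMeasurable).congr
        (Eventually.of_forall fun z => ?_)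
      simp only [Pi.mul_apply]
      ring
    · rw [mul_one, norm_mul, norm_mul, norm_mul, Real.norm_of_nonneg (Real.exp_pos _).le]
      by_cases hz : ρ + 2 ≤ ‖z.1‖
      · have h0 : planeWave ρ hρ 0 z.1 = 0 := by
          rw [planeWave, (cutoff n ρ hρ).zero_of_le_dist (by simpa [cutoff] using hz), zero_mul]
        simp [h0]
      · have h2 : Real.exp (inner ℝ z.1 (‖z.2‖⁻¹ • z.2)) ≤ Real.exp (ρ + 2) := by
          apply Real.exp_le_exp.2
          refine (real_inner_le_norm _ _).trans ?_
          have := mul_le_of_le_one_right (norm_nonneg z.1) (hdir z.2)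
          linarith
        calc _ = Real.exp (inner ℝ z.1 (‖z.2‖⁻¹ • z.2)) *
              (‖w z.1‖ * ‖planeWave ρ hρ 0 z.1‖) := by ring
          _ ≤ _ := by gcongr
  have hswap : ∫ x, w x * (planeWave ρ hρ 0 x * waveAverage x)
      = ∫ y in S, ∫ x, w x * planeWave ρ hρ (‖y‖⁻¹ • y) x := by
    have := integral_integral_swap (f := fun x y : Space n =>
      w x * (planeWave ρ hρ 0 x * Real.exp (inner ℝ x (‖y‖⁻¹ • y)))) hF
    simp only [integral_const_mul] at this
    simp only [hpw (_ • _)]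
    exact this
  rw [hswap]
  have hint : Integrable (fun y => ∫ x, w x * planeWave ρ hρ (‖y‖⁻¹ • y) x)
      (volume.restrict S) := by
    simp only [hpw (_ • _)]
    exact hF.integral_prod_right
  calc _ = ∫ _ in S, m := by rw [setIntegral_const, smul_eq_mul]
    _ ≤ _ := setIntegral_mono_on (integrable_const m) hint (measurableSet_annulus n)
      fun y hy => hm _ (norm_direction hy)

/-! ### Lower bounds for the nonlinearity -/

theorem isFiniteMeasure_restrict_closedBall {n : ℕ} (r : ℝ) :
    IsFiniteMeasure (volume.restrict (Metric.closedBall (0 : Space n) r)) :=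
  ⟨by rw [Measure.restrict_apply_univ]; exact measure_closedBall_lt_top⟩

/-- Hölder with weight 1: the volume of the ball is at most of order (1+t)^n because t + R ≤ R(1+t).
The constant does not depend on the truncation radius ρ, which later depends on T. -/
theorem mul_rpow_moment_le {n : ℕ} {p R : ℝ} (hp : 1 < p) (hR : 1 ≤ R) :
    ∃ c : ℝ, 0 < c ∧ ∀ {ρ t : ℝ} (hρ : 0 ≤ ρ) {w : Space n → ℝ}, 0 ≤ t → t + R ≤ ρ →
      MemLp w (ENNReal.ofReal p) (volume.restrict (Metric.closedBall 0 (t + R))) →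
      (∀ᵐ x, t + R < ‖x‖ → w x = 0) →
      c * ((1 + t) ^ (-(n * (p - 1))) * |∫ x, w x * planeWave ρ hρ 0 x| ^ p) ≤
        ∫ x, |w x| ^ p * planeWave ρ hρ 0 x := by
  have hp1 : 0 < p - 1 := by linarith
  have hpq := Real.HolderConjugate.conjExponent hp
  set V := volume.real (Metric.closedBall (0 : Space n) 1) with hV
  have hV0 : 0 < V := ENNReal.toReal_pos
    (Metric.measure_closedBall_pos volume _ one_pos).ne' measure_closedBall_lt_top.ne
  refine ⟨((R ^ n * V) ^ (p - 1))⁻¹, by positivity, ?_⟩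
  intro ρ t hρ w ht htρ hw hsupp
  have := isFiniteMeasure_restrict_closedBall (n := n) (t + R)
  have h := rpow_abs_integral_le hpq hρ htρ (W := fun _ => 1) hw hsupp (memLp_const 1)
    fun _ => zero_le_one
  have hvol : ∫ x in Metric.closedBall (0 : Space n) (t + R), (1 : ℝ) ^ p.conjExponent
      ≤ R ^ n * V * (1 + t) ^ n := by
    rw [Real.one_rpow, setIntegral_const, smul_eq_mul, mul_one,
      Measure.addHaar_real_closedBall' volume _ (by linarith), finrank_euclideanSpace,
      Fintype.card_fin]
    calc (t + R) ^ n * V ≤ (R * (1 + t)) ^ n * V := by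
          gcongr; nlinarith
      _ = _ := by rw [mul_pow]; ring
  simp only [mul_one] at h
  have hN0 : 0 ≤ ∫ x, |w x| ^ p * planeWave ρ hρ 0 x := integral_nonneg fun x =>
    mul_nonneg (Real.rpow_nonneg (abs_nonneg _) _) (planeWave_nonneg hρ 0 x)
  have hI0 : 0 ≤ ∫ x in Metric.closedBall (0 : Space n) (t + R), (1 : ℝ) ^ p.conjExponent :=
    integral_nonneg fun x => Real.rpow_nonneg zero_le_one _
  set N := ∫ x, |w x| ^ p * planeWave ρ hρ 0 x
  have h1t : 0 < 1 + t := by linarith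
  have e1 : (R ^ n * V * (1 + t) ^ n) ^ (p - 1)
      = (R ^ n * V) ^ (p - 1) * (1 + t) ^ (n * (p - 1)) := by
    rw [Real.mul_rpow (by positivity) (by positivity), ← Real.rpow_natCast (1 + t) n,
      ← Real.rpow_mul h1t.le]
  have h2 : |∫ x, w x * planeWave ρ hρ 0 x| ^ p
      ≤ N * ((R ^ n * V) ^ (p - 1) * (1 + t) ^ (n * (p - 1))) := by
    rw [← e1]
    refine h.trans ?_
    gcongr
  calc _ ≤ ((R ^ n * V) ^ (p - 1))⁻¹ * ((1 + t) ^ (-(n * (p - 1))) *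
        (N * ((R ^ n * V) ^ (p - 1) * (1 + t) ^ (n * (p - 1))))) := by gcongr
    _ = N := by
      rw [Real.rpow_neg h1t.le]
      have : (1 + t) ^ (n * (p - 1)) ≠ 0 := (Real.rpow_pos_of_pos h1t _).ne'
      have : (R ^ n * V) ^ (p - 1) ≠ 0 := (Real.rpow_pos_of_pos (by positivity) _).ne'
      field_simp

theorem memLp_waveAverage {n : ℕ} (hn : 1 ≤ n) (r : ℝ) (P : ℝ≥0∞) :
    MemLp (waveAverage (n := n)) P (volume.restrict (Metric.closedBall 0 r)) := by
  obtain ⟨C, hC, hle⟩ := waveAverage_le hn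
  have := isFiniteMeasure_restrict_closedBall (n := n) r
  refine MemLp.of_bound (measurable_waveAverage n).aestronglyMeasurable (C * Real.exp r)
    ((ae_restrict_iff' measurableSet_closedBall).2 (Eventually.of_forall fun x hx => ?_))
  have hx' : ‖x‖ ≤ r := by simpa using hx
  rw [Real.norm_of_nonneg (waveAverage_nonneg x)]
  have hn' : (0 : ℝ) ≤ n - 1 := by
    have : (1 : ℝ) ≤ n := by exact_mod_cast hn
    linarith
  have h1 : (1 + ‖x‖) ^ (-((n - 1 : ℝ) / 2)) ≤ 1 :=
    Real.rpow_le_one_of_one_le_of_nonpos (by linarith [norm_nonneg x]) (by linarith)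
  calc _ ≤ C * (Real.exp ‖x‖ * (1 + ‖x‖) ^ (-((n - 1 : ℝ) / 2))) := hle x
    _ ≤ C * (Real.exp r * 1) := by gcongr
    _ = _ := by ring

/-- Hölder against the averaged wave. For the conjugate exponent q one has q(p-1) = p, which turns
the powers e^{qt} and (1+t)^((n-1)(1-q/2)) into the stated ones. Again c is independent of ρ. -/
theorem mul_rpow_waveAverage_le {n : ℕ} (hn : 1 ≤ n) {p R : ℝ} (hp : 1 < p) (hR : 0 ≤ R) :
    ∃ c : ℝ, 0 < c ∧ ∀ {ρ t : ℝ} (hρ : 0 ≤ ρ) {w : Space n → ℝ}, 0 ≤ t → t + R ≤ ρ →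
      MemLp w (ENNReal.ofReal p) (volume.restrict (Metric.closedBall 0 (t + R))) →
      (∀ᵐ x, t + R < ‖x‖ → w x = 0) →
      c * (Real.exp (-(p * t)) * (1 + t) ^ (-((n - 1) * (p / 2 - 1))) *
        |∫ x, w x * (planeWave ρ hρ 0 x * waveAverage x)| ^ p) ≤
        ∫ x, |w x| ^ p * planeWave ρ hρ 0 x := by
  have hp1 : 0 < p - 1 := by linarith
  have hpq := Real.HolderConjugate.conjExponent hp
  set q := p.conjExponent with hq
  have hqp : q * (p - 1) = p := by
    rw [hpq.conjugate_eq]; field_simp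
  obtain ⟨C, hC, hle⟩ := setIntegral_waveAverage_rpow_le hn hpq.symm.pos
  set β := (n - 1 : ℝ) * (1 - q / 2) with hβ
  have hβp : β * (p - 1) = (n - 1) * (p / 2 - 1) := by
    rw [hβ]; linear_combination (-(n - 1 : ℝ) / 2) * hqp
  set C' := C * ((1 + R) ^ |β| * Real.exp (q * R)) with hC'
  have hC'0 : 0 < C' := by positivity
  clear_value C'
  refine ⟨(C' ^ (p - 1))⁻¹, by positivity, ?_⟩
  intro ρ t hρ w ht htρ hw hsupp
  have h := rpow_abs_integral_le hpq hρ htρ hw hsupp (memLp_waveAverage hn _ _) waveAverage_nonneg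
  have hN0 : 0 ≤ ∫ x, |w x| ^ p * planeWave ρ hρ 0 x := integral_nonneg fun x =>
    mul_nonneg (Real.rpow_nonneg (abs_nonneg _) _) (planeWave_nonneg hρ 0 x)
  have hI0 : 0 ≤ ∫ x in Metric.closedBall (0 : Space n) (t + R), waveAverage x ^ q :=
    integral_nonneg fun x => Real.rpow_nonneg (waveAverage_nonneg x) _
  set N := ∫ x, |w x| ^ p * planeWave ρ hρ 0 x
  have h1t : 0 < 1 + t := by linarith
  have hI : ∫ x in Metric.closedBall (0 : Space n) (t + R), waveAverage x ^ q
      ≤ C' * ((1 + t) ^ β * Real.exp (q * t)) := by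
    refine (hle (t + R) (by linarith)).trans ?_
    have h3 : (1 + (t + R)) ^ β ≤ (1 + R) ^ |β| * (1 + t) ^ β :=
      rpow_le_of_ratio (by positivity) h1t (by nlinarith) (by nlinarith)
    calc _ ≤ C * (((1 + R) ^ |β| * (1 + t) ^ β) * Real.exp (q * (t + R))) := by gcongr
      _ = _ := by rw [mul_add, Real.exp_add, hC']; ring
  have e1 : (C' * ((1 + t) ^ β * Real.exp (q * t))) ^ (p - 1)
      = C' ^ (p - 1) * ((1 + t) ^ ((n - 1) * (p / 2 - 1)) * Real.exp (p * t)) := by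
    rw [Real.mul_rpow hC'0.le (by positivity), Real.mul_rpow (by positivity) (by positivity),
      ← Real.rpow_mul h1t.le, hβp, ← Real.exp_mul, mul_right_comm, hqp]
  have h2 := h.trans (mul_le_mul_of_nonneg_left (Real.rpow_le_rpow hI0 hI hp1.le) hN0)
  rw [e1] at h2
  calc _ ≤ (C' ^ (p - 1))⁻¹ * (Real.exp (-(p * t)) * (1 + t) ^ (-((n - 1) * (p / 2 - 1))) *
        (N * (C' ^ (p - 1) * ((1 + t) ^ ((n - 1) * (p / 2 - 1)) * Real.exp (p * t))))) := by gcongr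
    _ = N := by
      rw [Real.rpow_neg h1t.le, Real.exp_neg]
      have : (1 + t) ^ ((n - 1) * (p / 2 - 1)) ≠ 0 := (Real.rpow_pos_of_pos h1t _).ne'
      have : C' ^ (p - 1) ≠ 0 := (Real.rpow_pos_of_pos hC'0 _).ne'
      field_simp

/-! ### Data -/

theorem exists_setIntegral_pos {n : ℕ} {h : Space n → ℝ} (hmem : MemLp h 2)
    (h0 : ∀ᵐ x, 0 ≤ h x) (hpos : ¬ ∀ᵐ x, h x = 0) :
    ∃ r : ℝ, 0 ≤ r ∧ 0 < ∫ x in Metric.closedBall (0 : Space n) r, h x := by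
  by_contra! hne
  apply hpos
  have hk (k : ℕ) : ∀ᵐ x, x ∈ Metric.closedBall (0 : Space n) k → h x = 0 := by
    have hint : IntegrableOn h (Metric.closedBall (0 : Space n) k) := by
      have := isFiniteMeasure_restrict_closedBall (n := n) k
      exact (hmem.restrict _).integrable one_le_two
    have h1 := (setIntegral_eq_zero_iff_of_nonneg_ae (ae_restrict_of_ae h0) hint).1
      (le_antisymm (hne k (Nat.cast_nonneg k))
        (integral_nonneg_of_ae (ae_restrict_of_ae h0)))
    exact (ae_restrict_iff' measurableSet_closedBall).1 h1
  filter_upwards [ae_all_iff.2 hk] with x hx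
  obtain ⟨k, hk⟩ := exists_nat_ge ‖x‖
  exact hx k (by simpa using hk)

/-- Uniformity in the direction and the truncation radius is the point: it lets one H serve all
moments and all T. -/
theorem setIntegral_le_integral_planeWave {n : ℕ} {h : Space n → ℝ} (hmem : MemLp h 2)
    (h0 : ∀ᵐ x, 0 ≤ h x) {r ρ : ℝ} (hρ : 0 ≤ ρ) (hr : r ≤ ρ) {ξ : Space n} (hξ : ‖ξ‖ ≤ 1) :
    Real.exp (-r) * ∫ x in Metric.closedBall (0 : Space n) r, h x ≤
      ∫ x, h x * planeWave ρ hρ ξ x := by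
  have hint : Integrable fun x => h x * planeWave ρ hρ ξ x :=
    hmem.integrable_mul ((contDiff_planeWave hρ ξ).continuous.memLp_of_hasCompactSupport
      (hasCompactSupport_planeWave hρ ξ) (p := 2))
  have hinth : IntegrableOn h (Metric.closedBall (0 : Space n) r) := by
    have := isFiniteMeasure_restrict_closedBall (n := n) r
    exact (hmem.restrict _).integrable one_le_two
  rw [← integral_const_mul]
  refine (integral_mono_ae (hinth.const_mul _) hint.integrableOn ?_).trans
    (setIntegral_le_integral hint ?_)
  · filter_upwards [ae_restrict_of_ae h0, ae_restrict_mem measurableSet_closedBall] with x hx hmem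
    have hxr : ‖x‖ ≤ r := by simpa using hmem
    rw [planeWave_eq hρ ξ (by linarith), mul_comm]
    gcongr
    have h1 := abs_le.1 (abs_real_inner_le_norm x ξ)
    have h2 := mul_le_of_le_one_right (norm_nonneg x) hξ
    linarith [h1.1]
  · filter_upwards [h0] with x hx
    exact mul_nonneg hx (planeWave_nonneg hρ ξ x)

/-! ### Reduction to the logarithmic system -/

/-- All PDE information enters here, with constants fixed before ε, T and u. The moment with ξ = 0
supplies the system and, by Hölder, the exponent 2 + κ - n(p-1) - κp = γ_F; the moments with |ξ| = 1
serve only to bound the same nonlinearity from below. -/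
theorem IsEnergySolution.exists_logSystem {n : ℕ} (hn : 1 ≤ n) {μ₁ μ₂ δ : ℝ}
    (hδ : δ = discr μ₁ μ₂) (hδ0 : 0 ≤ δ) {p : ℝ} (hp : 1 < p) {f g h : Space n → ℝ}
    (hf : MemLp f 2) (hg : MemLp g 2)
    (hh : ∀ x, h x = (μ₁ - 1 + Real.sqrt δ) / 2 * f x + g x)
    (hf0 : ∀ᵐ x, 0 ≤ f x) (hh0 : ∀ᵐ x, 0 ≤ h x) (hhpos : ¬ ∀ᵐ x, h x = 0)
    {R : ℝ} (hR : 1 ≤ R) :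
    ∃ c c' H τ₁ : ℝ, 0 < c ∧ 0 < c' ∧ 0 < H ∧ 0 ≤ τ₁ ∧ ∀ {ε T : ℝ}, 0 < ε → 0 < T →
      ∀ u : ℝ → Lp ℝ 2 (volume : Measure (Space n)), IsEnergySolution n μ₁ μ₂ p ε f g T u →
        SupportedInCone R T u → ∃ F D P : ℝ → ℝ,
          LogSystem (Real.sqrt δ) (ε * H) (Real.log (1 + T)) F D P ∧
          (∀ τ ∈ Ioo 0 (Real.log (1 + T)),
            c * (Real.exp (gammaF p (heatDim n μ₁ δ) * τ) * F τ ^ p) ≤ P τ) ∧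
          (∀ τ ∈ Ioo 0 (Real.log (1 + T)), τ₁ ≤ τ →
            c' * (ε ^ p * Real.exp ((1 + n + (μ₁ - 1 - Real.sqrt δ) / 2
              - (n + μ₁ - 1) * p / 2) * τ)) ≤ P τ) := by
  set a := (μ₁ - 1 + Real.sqrt δ) / 2 with ha
  set κ := (μ₁ - 1 - Real.sqrt δ) / 2 with hκ
  have hs : a + κ = μ₁ - 1 := by rw [ha, hκ]; ring
  have hm : a * κ = μ₂ := by
    have := Real.sq_sqrt hδ0
    rw [hδ, discr] at this
    rw [ha, hκ, hδ, discr]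
    linear_combination (-1 / 4) * this
  have hak : a - κ = Real.sqrt δ := by rw [ha, hκ]; ring
  have hκa : κ ≤ a := by linarith [Real.sqrt_nonneg δ]
  have hhmem : MemLp h 2 := by
    have : h = fun x => a * f x + g x := funext hh
    rw [this]
    exact (hf.const_mul a).add hg
  obtain ⟨r₀, hr₀, hI⟩ := exists_setIntegral_pos hhmem hh0 hhpos
  set H := Real.exp (-r₀) * ∫ x in Metric.closedBall (0 : Space n) r₀, h x with hH
  have hH0 : 0 < H := mul_pos (Real.exp_pos _) hI
  obtain ⟨c, hc, hcle⟩ := mul_rpow_moment_le (n := n) hp hR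
  obtain ⟨c₁, hc₁, hc₁le⟩ := MomentSystem.exp_growth hs hm hκa
  obtain ⟨c₂, hc₂, hc₂le⟩ := mul_rpow_waveAverage_le hn hp (zero_le_one.trans hR)
  set V := volume.real (Metric.closedBall (0 : Space n) 2 \ Metric.ball 0 1) with hV
  have hV0 : 0 < V := volume_annulus_pos hn
  -- The exponential growth starts at t = 2 + (a - κ), and τ = log(1+t).
  refine ⟨c, c₂ * (V * (c₁ * H)) ^ p, H, Real.log (3 + (a - κ)), hc, by positivity, hH0,
    Real.log_nonneg (by linarith), ?_⟩
  intro ε T hε hT u hu hsupp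
  -- Large enough for the ball on which h has positive mass and for the support of u up to time T.
  set ρ := max r₀ (T + R) with hρdef
  have hρ : 0 ≤ ρ := hr₀.trans (le_max_left _ _)
  obtain ⟨hloc, hmom⟩ := hu.momentSystem hp hT hρ (le_max_right _ _) hsupp
  have hint (w : Space n → ℝ) (hw : MemLp w 2) (ξ : Space n) :
      Integrable fun x => w x * planeWave ρ hρ ξ x :=
    hw.integrable_mul ((contDiff_planeWave hρ ξ).continuous.memLp_of_hasCompactSupport
      (hasCompactSupport_planeWave hρ ξ) (p := 2))
  have hdata (ξ : Space n) (hξ : ‖ξ‖ ≤ 1) : 0 ≤ ε * ∫ x, f x * planeWave ρ hρ ξ x ∧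
      ε * H ≤ a * (ε * ∫ x, f x * planeWave ρ hρ ξ x) + ε * ∫ x, g x * planeWave ρ hρ ξ x := by
    constructor
    · refine mul_nonneg hε.le (integral_nonneg_of_ae ?_)
      filter_upwards [hf0] with x hx
      exact mul_nonneg hx (planeWave_nonneg hρ ξ x)
    · have h1 := setIntegral_le_integral_planeWave hhmem hh0 hρ (le_max_left _ _ : r₀ ≤ ρ) hξ
      have h2 : ∫ x, h x * planeWave ρ hρ ξ x
          = a * (∫ x, f x * planeWave ρ hρ ξ x) + ∫ x, g x * planeWave ρ hρ ξ x := by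
        rw [← integral_const_mul, ← integral_add ((hint f hf ξ).const_mul a) (hint g hg ξ)]
        congr 1
        ext x
        rw [hh]; ring
      rw [h2] at h1
      calc ε * H ≤ ε * (a * (∫ x, f x * planeWave ρ hρ ξ x) + ∫ x, g x * planeWave ρ hρ ξ x) := by
            gcongr
        _ = _ := by ring
  obtain ⟨B, hsys, hA0, hB0⟩ := hmom 0
  rw [norm_zero, zero_pow two_ne_zero] at hsys
  obtain ⟨hd1, hd2⟩ := hdata 0 (by simp)
  have hlog := hsys.logSystem hs hm (mul_pos hε hH0) (by rw [hA0]; exact hd1)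
    (by rw [hA0, hB0]; exact hd2) hT
  rw [hak] at hlog
  have hoo {τ : ℝ} (hτ : τ ∈ Ioo 0 (Real.log (1 + T))) : Real.exp τ - 1 ∈ Ioo 0 T := by
    have := (Real.lt_log_iff_exp_lt (by linarith)).1 hτ.2
    exact ⟨by linarith [Real.one_lt_exp_iff.2 hτ.1], by linarith⟩
  have hLp {t : ℝ} (ht : t ∈ Ioo 0 T) := (hloc _ (isCompact_closedBall 0 (t + R)) t ht).1
  refine ⟨_, _, _, hlog, ?_, ?_⟩
  · intro τ hτ
    have ht := hoo hτ
    set t := Real.exp τ - 1 with htdef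
    have h1t : 1 + t = Real.exp τ := by rw [htdef]; ring
    have hle := hcle hρ ht.1.le (by linarith [ht.2, le_max_right r₀ (T + R)]) (hLp ht)
      (hsupp t (Ioo_subset_Ico_self ht))
    have hA := (hsys.nonneg_and_le_weighted hs hm le_rfl (mul_pos hε hH0) (by rw [hA0]; exact hd1)
      (by rw [hA0, hB0]; exact hd2) (Ioo_subset_Ico_self ht)).1
    rw [abs_of_nonneg hA, h1t, ← Real.exp_mul] at hle
    rw [h1t, ← Real.exp_mul, Real.mul_rpow (Real.exp_pos _).le hA, ← Real.exp_mul]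
    set A := ∫ x, u t x * planeWave ρ hρ 0 x
    calc _ = Real.exp ((2 + κ) * τ) * (c * (Real.exp (τ * -(n * (p - 1))) * A ^ p)) := by
          have : Real.exp (gammaF p (heatDim n μ₁ δ) * τ) * Real.exp (τ * κ * p)
              = Real.exp ((2 + κ) * τ) * Real.exp (τ * -(n * (p - 1))) := by
            rw [← Real.exp_add, ← Real.exp_add, gammaF, heatDim]
            congr 1; ring
          linear_combination (c * A ^ p) * this
      _ ≤ _ := by gcongr
  · intro τ hτ hτ1
    have ht := hoo hτ
    have hτ1' := (Real.log_le_iff_le_exp (by linarith)).1 hτ1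
    set t := Real.exp τ - 1 with htdef
    have h1t : 1 + t = Real.exp τ := by rw [htdef]; ring
    have hle := hc₂le hρ ht.1.le (by linarith [ht.2, le_max_right r₀ (T + R)]) (hLp ht)
      (hsupp t (Ioo_subset_Ico_self ht))
    have hgrow (ξ : Space n) (hξ : ‖ξ‖ = 1) :
        c₁ * (ε * H) * (Real.exp t * (1 + t) ^ (-(μ₁ / 2)))
          ≤ ∫ x, u t x * planeWave ρ hρ ξ x := by
      obtain ⟨B', hsys', hA0', hB0'⟩ := hmom ξ
      rw [hξ, one_pow] at hsys'
      obtain ⟨hd1', hd2'⟩ := hdata ξ hξ.le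
      exact hc₁le hsys' (mul_pos hε hH0) (by rw [hA0']; exact hd1')
        (by rw [hA0', hB0']; exact hd2') t (by linarith) ht.2
    have havg := le_integral_mul_waveAverage hρ (Lp.memLp (u t)) hgrow
    set I := ∫ x, u t x * (planeWave ρ hρ 0 x * waveAverage x)
    rw [h1t, ← Real.exp_mul] at havg hle
    have hlow : V * (c₁ * H) * (ε * (Real.exp t * Real.exp (τ * -(μ₁ / 2)))) ≤ |I| := by
      refine le_trans ?_ (le_abs_self I)
      refine le_trans (le_of_eq ?_) havg
      ring
    have hlowp := Real.rpow_le_rpow (by positivity) hlow (by linarith : 0 ≤ p)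
    rw [Real.mul_rpow (by positivity) (by positivity), Real.mul_rpow hε.le (by positivity),
      ← Real.exp_add, ← Real.exp_mul] at hlowp
    set N := ∫ x, |u t x| ^ p * planeWave ρ hρ 0 x
    calc _ = Real.exp ((2 + κ) * τ) * (c₂ * (Real.exp (-(p * t)) *
          Real.exp (τ * -((n - 1) * (p / 2 - 1))) *
          ((V * (c₁ * H)) ^ p * (ε ^ p * Real.exp ((t + τ * -(μ₁ / 2)) * p))))) := by
          -- The factor e^{-pt} from Hölder cancels e^{pt} from the growth; only powers of 1 + t =
          -- e^τ remain.
          have : Real.exp ((1 + n + κ - (n + μ₁ - 1) * p / 2) * τ)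
              = Real.exp ((2 + κ) * τ) * (Real.exp (-(p * t)) *
                Real.exp (τ * -((n - 1) * (p / 2 - 1))) *
                Real.exp ((t + τ * -(μ₁ / 2)) * p)) := by
            rw [← Real.exp_add, ← Real.exp_add, ← Real.exp_add]
            congr 1; ring
          rw [this]; ring
      _ ≤ Real.exp ((2 + κ) * τ) * (c₂ * (Real.exp (-(p * t)) *
          Real.exp (τ * -((n - 1) * (p / 2 - 1))) * |I| ^ p)) := by gcongr
      _ ≤ _ := by gcongr

/-! ### Exponents -/

theorem gammaF_pos_of_lt_fujitaExponent {p ν : ℝ} (hp : 1 < p)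
    (h : (p : EReal) < fujitaExponent ν) :
    0 < gammaF p ν := by
  rw [gammaF]
  rw [fujitaExponent] at h
  split_ifs at h with hν
  · rw [EReal.coe_lt_coe_iff, ← sub_lt_iff_lt_add', lt_div_iff₀ hν] at h
    linarith
  · nlinarith

/-- Completing the square: for ν > 1 the Strauss exponent is the larger root of γ_S(·, ν). -/
theorem sq_sub_sq_eq_mul_gammaS {p ν : ℝ} (hν : 1 < ν) :
    Real.sqrt (ν ^ 2 + 10 * ν - 7) ^ 2 - (2 * (ν - 1) * p - (ν + 1)) ^ 2
      = 4 * (ν - 1) * gammaS p ν := by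
  rw [Real.sq_sqrt (by nlinarith), gammaS]
  ring

theorem add_one_le_sqrt {ν : ℝ} (hν : 1 < ν) : ν + 1 ≤ Real.sqrt (ν ^ 2 + 10 * ν - 7) :=
  Real.le_sqrt_of_sq_le (by nlinarith)

theorem gammaS_pos_of_lt_straussExponent {p ν : ℝ} (hp : 1 < p)
    (h : (p : EReal) < straussExponent ν) : 0 < gammaS p ν := by
  rw [straussExponent] at h
  split_ifs at h with hν
  · rw [EReal.coe_lt_coe_iff, lt_div_iff₀ (by linarith)] at h
    have h1 := sq_sub_sq_eq_mul_gammaS (p := p) hν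
    have h2 := add_one_le_sqrt hν
    have h3 : 0 < (ν - 1) * p := mul_pos (by linarith) (by linarith)
    set S := Real.sqrt (ν ^ 2 + 10 * ν - 7)
    have h4 : 0 < 4 * (ν - 1) * gammaS p ν := by
      rw [← h1, sq_sub_sq]
      exact mul_pos (by linarith) (by linarith)
    exact pos_of_mul_pos_right h4 (by linarith)
  · rw [gammaS]
    nlinarith [mul_pos (sub_pos.2 hp) (sub_pos.2 hp)]

/-- For ν > 1 one has p_S(ν) d_*(ν) = 2, by the difference of squares S² - (ν+1)² = 8(ν-1). -/
theorem mul_dStar_le_of_lt_straussExponent {p ν : ℝ} (h : (p : EReal) < straussExponent ν) :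
    p * dStar ν ≤ 2 := by
  rw [straussExponent] at h
  rw [dStar]
  split_ifs at h ⊢ with hν
  · rw [EReal.coe_lt_coe_iff, lt_div_iff₀ (by linarith)] at h
    have h2 := add_one_le_sqrt hν
    have h3 := Real.sq_sqrt (show 0 ≤ ν ^ 2 + 10 * ν - 7 by nlinarith)
    set S := Real.sqrt (ν ^ 2 + 10 * ν - 7)
    have h4 : p * (2 * (ν - 1)) * (S - (ν + 1)) ≤ (ν + 1 + S) * (S - (ν + 1)) :=
      mul_le_mul_of_nonneg_right h.le (by linarith)
    have h5 : (ν + 1 + S) * (S - (ν + 1)) = 8 * (ν - 1) := by linear_combination h3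
    have h6 : p * (S - (ν + 1)) * (2 * (ν - 1)) ≤ 4 * (2 * (ν - 1)) := by linarith
    have := le_of_mul_le_mul_right h6 (by linarith)
    linarith
  · simp

theorem dStar_nonneg (ν : ℝ) : 0 ≤ dStar ν := by
  rw [dStar]
  split_ifs with hν
  · linarith [add_one_le_sqrt hν]
  · exact le_rfl

/-- The sign of 2 - p(n - √δ) thus decides which of the two exponents dominates, and positivity of
the smaller passes to the larger in the next two lemmas. -/
theorem two_mul_gammaF_sub_gammaS (n : ℕ) (μ₁ δ p : ℝ) :
    2 * p * gammaF p (heatDim n μ₁ δ) - gammaS p (n + μ₁)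
      = (p - 1) * (2 - p * (n - Real.sqrt δ)) := by
  rw [gammaF, gammaS, heatDim]
  ring

theorem gammaF_pos_of_mul_le {n : ℕ} {μ₁ δ p : ℝ} (hp1 : 1 < p)
    (hp : (p : EReal) < blowupExponent n μ₁ δ)
    (h : (p : EReal) < straussExponent (n + μ₁) → p * (n - Real.sqrt δ) ≤ 2) :
    0 < gammaF p (heatDim n μ₁ δ) := by
  rcases lt_max_iff.1 hp with hF | hS
  · exact gammaF_pos_of_lt_fujitaExponent hp1 hF
  · have h1 := gammaS_pos_of_lt_straussExponent hp1 hS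
    have h2 := two_mul_gammaF_sub_gammaS n μ₁ δ p
    have h3 : 0 ≤ (p - 1) * (2 - p * (n - Real.sqrt δ)) :=
      mul_nonneg (by linarith) (by linarith [h hS])
    have h4 : 0 < 2 * p * gammaF p (heatDim n μ₁ δ) := by linarith
    exact pos_of_mul_pos_right h4 (by linarith)

theorem gammaS_pos_of_le_mul {n : ℕ} {μ₁ δ p : ℝ} (hp1 : 1 < p)
    (hp : (p : EReal) < blowupExponent n μ₁ δ) (h : 2 ≤ p * (n - Real.sqrt δ)) :
    0 < gammaS p (n + μ₁) := by
  rcases lt_max_iff.1 hp with hF | hS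
  · have h1 := gammaF_pos_of_lt_fujitaExponent hp1 hF
    have h2 := two_mul_gammaF_sub_gammaS n μ₁ δ p
    have h3 : 0 ≤ (p - 1) * (p * (n - Real.sqrt δ) - 2) :=
      mul_nonneg (by linarith) (by linarith)
    have h4 : 0 < 2 * p * gammaF p (heatDim n μ₁ δ) := by positivity
    linarith
  · exact gammaS_pos_of_lt_straussExponent hp1 hS

/-! ### The heat-like time scale -/

/-- Matches the exponent of the logarithm with the alternative b = 0 of `LogSystem.le_of_heat`,
where b = √δ. -/
theorem one_sub_sign_eq {δ : ℝ} (hδ0 : 0 ≤ δ) :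
    1 - Real.sign δ = if Real.sqrt δ = 0 then 1 else 0 := by
  rcases hδ0.eq_or_lt with h | h
  · simp [← h]
  · rw [Real.sign_of_pos h, if_neg (Real.sqrt_pos.2 h).ne', sub_self]

theorem strictMonoOn_heatScale {a b : ℝ} (ha : 0 < a) (hb : 0 ≤ b) :
    StrictMonoOn (fun y : ℝ => y ^ a * Real.log (1 + y) ^ b) (Ioi 0) := by
  intro x hx y hy hxy
  have hx0 : (0 : ℝ) < x := hx
  have hlog : 0 < Real.log (1 + x) := Real.log_pos (by linarith)
  have h1 : x ^ a < y ^ a := Real.rpow_lt_rpow hx0.le hxy ha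
  have h2 : Real.log (1 + x) ^ b ≤ Real.log (1 + y) ^ b :=
    Real.rpow_le_rpow hlog.le (Real.log_le_log (by linarith) (by linarith)) hb
  exact mul_lt_mul h1 h2 (Real.rpow_pos_of_pos hlog _) (Real.rpow_nonneg (hx0.trans hxy).le _)

/-- Let z solve the equation without its logarithm. The logarithmic factor is at most 1 at min(1, z)
and at least 1 at max(e, z), so a solution lies between. -/
theorem exists_heatScale {a b ε : ℝ} (ha : 0 < a) (hb : 0 ≤ b) (hε : 0 < ε) :
    ∃ y : ℝ, 0 < y ∧ ε * y ^ a * Real.log (1 + y) ^ b = 1 := by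
  set z := ε⁻¹ ^ (1 / a) with hz
  have hz0 : 0 < z := Real.rpow_pos_of_pos (inv_pos.2 hε) _
  have hza : z ^ a = ε⁻¹ := by
    rw [hz, ← Real.rpow_mul (inv_pos.2 hε).le, one_div_mul_cancel ha.ne', Real.rpow_one]
  have hcont : ContinuousOn (fun y : ℝ => y ^ a * Real.log (1 + y) ^ b)
      (Icc (min 1 z) (max (Real.exp 1) z)) := by
    have hpos : ∀ y ∈ Icc (min 1 z) (max (Real.exp 1) z), 0 < y := fun y hy =>
      (lt_min one_pos hz0).trans_le hy.1
    refine ContinuousOn.mul (continuousOn_id.rpow_const fun _ _ => Or.inr ha.le)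
      (ContinuousOn.rpow_const (ContinuousOn.log (by fun_prop) fun y hy => ?_)
        fun _ _ => Or.inr hb)
    linarith [hpos y hy]
  have hlow : min 1 z ^ a * Real.log (1 + min 1 z) ^ b ≤ ε⁻¹ := by
    have hm : 0 < min 1 z := lt_min one_pos hz0
    have hmz : min 1 z ≤ z := min_le_right _ _
    have h1 : Real.log (1 + min 1 z) ≤ 1 := by
      have := Real.log_le_sub_one_of_pos (show 0 < 1 + min 1 z by linarith)
      linarith [min_le_left 1 z]
    have h2 : Real.log (1 + min 1 z) ^ b ≤ 1 :=
      Real.rpow_le_one (Real.log_nonneg (by linarith)) h1 hb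
    have h3 : 0 ≤ Real.log (1 + min 1 z) ^ b :=
      Real.rpow_nonneg (Real.log_nonneg (by linarith)) _
    calc _ ≤ z ^ a * 1 := by gcongr
      _ = _ := by rw [hza, mul_one]
  have hup : ε⁻¹ ≤ max (Real.exp 1) z ^ a * Real.log (1 + max (Real.exp 1) z) ^ b := by
    have hm : Real.exp 1 ≤ max (Real.exp 1) z := le_max_left _ _
    have h1 : 1 ≤ Real.log (1 + max (Real.exp 1) z) := by
      rw [Real.le_log_iff_exp_le (by linarith [Real.exp_pos 1])]
      linarith
    have h2 : 1 ≤ Real.log (1 + max (Real.exp 1) z) ^ b := Real.one_le_rpow h1 hb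
    calc ε⁻¹ = z ^ a * 1 := by rw [hza, mul_one]
      _ ≤ _ := by
        have hzm : z ≤ max (Real.exp 1) z := le_max_right _ _
        gcongr
  obtain ⟨y, hy, hyeq⟩ := intermediate_value_Icc
    ((min_le_right 1 z).trans (le_max_right _ _)) hcont ⟨hlow, hup⟩
  refine ⟨y, (lt_min one_pos hz0).trans_le hy.1, ?_⟩
  simp only [] at hyeq
  rw [mul_assoc, hyeq, mul_inv_cancel₀ hε.ne']

/-- Taken with ε₁ = ε₂ in both orders, this also gives uniqueness. -/
theorem IsHeatScale.le_of_le {n : ℕ} {μ₁ δ p ε₁ ε₂ y₁ y₂ : ℝ} (hδ0 : 0 ≤ δ) (hp : 1 < p)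
    (hγ : 0 < gammaF p (heatDim n μ₁ δ)) (h₁ : IsHeatScale n μ₁ δ p ε₁ y₁)
    (h₂ : IsHeatScale n μ₁ δ p ε₂ y₂) (hε₁ : 0 < ε₁) (hε : ε₁ ≤ ε₂) : y₂ ≤ y₁ := by
  have hb : 0 ≤ 1 - Real.sign δ := by
    rw [one_sub_sign_eq hδ0]; split_ifs <;> norm_num
  have hmono := strictMonoOn_heatScale (div_pos hγ (sub_pos.2 hp)) hb
  refine (hmono.le_iff_le h₂.1 h₁.1).1 ?_
  have e₁ := eq_inv_of_mul_eq_one_right ((mul_assoc _ _ _).symm.trans h₁.2)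
  have e₂ := eq_inv_of_mul_eq_one_right ((mul_assoc _ _ _).symm.trans h₂.2)
  change _ * _ ≤ _ * _
  rw [e₁, e₂]
  exact inv_anti₀ hε₁ hε

/-- Positivity of γ_F is assumed only after φ is chosen, since a function must be supplied also in
the wave regimes, where γ_F need not be positive. -/
theorem exists_isHeatScale (n : ℕ) (μ₁ : ℝ) {δ p : ℝ} (hδ0 : 0 ≤ δ) (hp : 1 < p) :
    ∃ φ : ℝ → ℝ, 0 < gammaF p (heatDim n μ₁ δ) → ∀ ε, 0 < ε → IsHeatScale n μ₁ δ p ε (φ ε) := by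
  have hb : 0 ≤ 1 - Real.sign δ := by
    rw [one_sub_sign_eq hδ0]; split_ifs <;> norm_num
  have (ε : ℝ) : ∃ y, 0 < gammaF p (heatDim n μ₁ δ) → 0 < ε → IsHeatScale n μ₁ δ p ε y := by
    by_cases h : 0 < gammaF p (heatDim n μ₁ δ) ∧ 0 < ε
    · obtain ⟨y, hy⟩ := exists_heatScale (div_pos h.1 (sub_pos.2 hp)) hb h.2
      exact ⟨y, fun _ _ => hy⟩
    · exact ⟨0, fun h1 h2 => absurd ⟨h1, h2⟩ h⟩
  choose φ hφ using this
  exact ⟨φ, fun hγ ε hε => hφ ε hγ hε⟩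

theorem IsHeatScale.eq_rpow {n : ℕ} {μ₁ δ p ε y : ℝ} (hp : 1 < p) (hδ : 0 < δ)
    (hγ : 0 < gammaF p (heatDim n μ₁ δ)) (h : IsHeatScale n μ₁ δ p ε y) :
    y = ε ^ (-(p - 1) / gammaF p (heatDim n μ₁ δ)) := by
  have hp1 : 0 < p - 1 := by linarith
  obtain ⟨hy, heq⟩ := h
  rw [Real.sign_of_pos hδ, sub_self, Real.rpow_zero, mul_one] at heq
  have e := eq_inv_of_mul_eq_one_left heq
  set γ := gammaF p (heatDim n μ₁ δ)
  rw [e, ← Real.rpow_neg_one, ← Real.rpow_mul hy.le, ← Real.rpow_mul hy.le,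
    show γ / (p - 1) * -1 * (-(p - 1) / γ) = 1 by field_simp, Real.rpow_one]

/-! ### Lifespan estimates -/

theorem LogSystem.exists_le_heatScale {n : ℕ} {μ₁ δ p c H : ℝ} (hδ0 : 0 ≤ δ) (hp : 1 < p)
    (hγ : 0 < gammaF p (heatDim n μ₁ δ)) (hc : 0 < c) (hH : 0 < H) {φ : ℝ → ℝ}
    (hφ : ∀ ε, 0 < ε → IsHeatScale n μ₁ δ p ε (φ ε)) :
    ∃ C : ℝ, 0 < C ∧ ∀ {ε T : ℝ} {F D P : ℝ → ℝ}, 0 < ε → ε ≤ 1 → 0 < T →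
      LogSystem (Real.sqrt δ) (ε * H) (Real.log (1 + T)) F D P →
      (∀ τ ∈ Ioo 0 (Real.log (1 + T)),
        c * (Real.exp (gammaF p (heatDim n μ₁ δ) * τ) * F τ ^ p) ≤ P τ) → T ≤ C * φ ε := by
  set γ := gammaF p (heatDim n μ₁ δ) with hγdef
  have hp1 : 0 < p - 1 := by linarith
  have ha : 0 < γ / (p - 1) := by positivity
  set a := γ / (p - 1) with hadef
  obtain ⟨K, hK, hheat⟩ := LogSystem.le_of_heat (γ := γ) hp (Real.sqrt_nonneg δ) hc hH
  have hφ1 := (hφ 1 one_pos).1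
  -- The blow-up criterion is applied at τ₀ = log(1 + M φ(ε)). The entry with K makes it hold; the
  -- last one gives τ₀ ≥ 2 for every ε ≤ 1, because φ(1) ≤ φ(ε).
  set M := max 1 (max (K ^ (1 / a)) (Real.exp 2 / φ 1)) with hM
  have hM1 : 1 ≤ M := le_max_left _ _
  have hMK : K ≤ M ^ a := by
    have h1 : K ^ (1 / a) ≤ M := (le_max_left _ _).trans (le_max_right _ _)
    have h2 := Real.rpow_le_rpow (by positivity) h1 ha.le
    rwa [← Real.rpow_mul hK.le, one_div_mul_cancel ha.ne', Real.rpow_one] at h2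
  have hMφ : Real.exp 2 ≤ M * φ 1 := by
    have h1 : Real.exp 2 / φ 1 ≤ M := (le_max_right _ _).trans (le_max_right _ _)
    rwa [div_le_iff₀ hφ1] at h1
  refine ⟨Real.exp 1 * (2 * M), by positivity, ?_⟩
  intro ε T F D P hε hε1 hT hsys hP
  obtain ⟨hy, heq⟩ := hφ ε hε
  have hφle : φ 1 ≤ φ ε := (hφ ε hε).le_of_le hδ0 hp hγ (hφ 1 one_pos) hε hε1
  set y := φ ε
  have hMy : Real.exp 2 ≤ M * y := hMφ.trans (by gcongr)
  have hMy1 : 1 ≤ M * y := (Real.one_le_exp (by norm_num)).trans hMy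
  have hτ₀ : 2 ≤ Real.log (1 + M * y) := by
    rw [Real.le_log_iff_exp_le (by linarith)]
    linarith
  have hX : K ≤ ε * (if Real.sqrt δ = 0 then Real.log (1 + M * y) else 1)
      * Real.exp (a * Real.log (1 + M * y)) := by
    have h1 : (M * y) ^ a ≤ Real.exp (a * Real.log (1 + M * y)) := by
      rw [mul_comm a, Real.exp_mul, Real.exp_log (by linarith)]
      exact Real.rpow_le_rpow (by linarith) (by linarith) ha.le
    have h2 : Real.log (1 + y) ^ (1 - Real.sign δ)
        ≤ if Real.sqrt δ = 0 then Real.log (1 + M * y) else 1 := by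
      rw [one_sub_sign_eq hδ0]
      split_ifs
      · rw [Real.rpow_one]
        exact Real.log_le_log (by linarith) (by nlinarith)
      · rw [Real.rpow_zero]
    have hlog0 : 0 ≤ Real.log (1 + y) ^ (1 - Real.sign δ) :=
      Real.rpow_nonneg (Real.log_nonneg (by linarith)) _
    calc K ≤ M ^ a * 1 := by rwa [mul_one]
      _ = ε * Real.log (1 + y) ^ (1 - Real.sign δ) * (M * y) ^ a := by
        rw [← hγdef, ← hadef] at heq
        rw [Real.mul_rpow (by linarith) hy.le]
        linear_combination (-M ^ a) * heq
      _ ≤ _ := by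
        have := hlog0.trans h2
        gcongr
  have hfin := hheat hε hsys hP _ hτ₀ hX
  have h3 := Real.exp_le_exp.2 hfin
  rw [Real.exp_add, Real.exp_log (by linarith), Real.exp_log (by linarith)] at h3
  nlinarith [Real.exp_pos 1]

theorem LogSystem.exists_le_rpow {n : ℕ} {μ₁ δ p c c' τ₁ : ℝ} (hp : 1 < p)
    (hγ : 0 < gammaS p (n + μ₁)) (hc : 0 < c) (hc' : 0 < c') (hτ₁ : 0 ≤ τ₁) :
    ∃ C : ℝ, 0 < C ∧ ∀ {ε m T : ℝ} {F D P : ℝ → ℝ}, 0 < ε → ε ≤ 1 → 0 ≤ m → 0 < T →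
      LogSystem (Real.sqrt δ) m (Real.log (1 + T)) F D P →
      (∀ τ ∈ Ioo 0 (Real.log (1 + T)),
        c * (Real.exp (gammaF p (heatDim n μ₁ δ) * τ) * F τ ^ p) ≤ P τ) →
      (∀ τ ∈ Ioo 0 (Real.log (1 + T)), τ₁ ≤ τ → c' * (ε ^ p * Real.exp ((1 + n
        + (μ₁ - 1 - Real.sqrt δ) / 2 - (n + μ₁ - 1) * p / 2) * τ)) ≤ P τ) →
      T ≤ C * ε ^ (-(2 * p * (p - 1)) / gammaS p (n + μ₁)) := by
  have hp1 : 0 < p - 1 := by linarith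
  obtain ⟨K, hK, hwave⟩ := LogSystem.le_of_wave (γ := gammaF p (heatDim n μ₁ δ))
    (β := 1 + n + (μ₁ - 1 - Real.sqrt δ) / 2 - (n + μ₁ - 1) * p / 2) hp (Real.sqrt_nonneg δ) hc hc'
    hτ₁
  -- In this sum √δ cancels, so the exponent of the wave bound depends on n + μ₁ and p only.
  have hs_eq : 1 + n + (μ₁ - 1 - Real.sqrt δ) / 2 - (n + μ₁ - 1) * p / 2
      + gammaF p (heatDim n μ₁ δ) / (p - 1) = gammaS p (n + μ₁) / (2 * (p - 1)) := by
    rw [gammaF, gammaS, heatDim]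
    field_simp
    ring
  rw [hs_eq] at hwave
  set s := gammaS p (n + μ₁) / (2 * (p - 1)) with hs
  have hs0 : 0 < s := by positivity
  have hexp : -(2 * p * (p - 1)) / gammaS p (n + μ₁) = -(p / s) := by
    rw [hs]; field_simp
  rw [hexp]
  -- The criterion is applied at e^{τ₀} = M ε^(-p/s): the first entry gives τ₀ ≥ τ₁ + 3, the second
  -- reaches the threshold K.
  set M := max (Real.exp (τ₁ + 3)) (K ^ (1 / s)) with hM
  have hM0 : 0 < M := lt_max_of_lt_left (Real.exp_pos _)
  have hMK : K ≤ M ^ s := by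
    have h2 := Real.rpow_le_rpow (by positivity) (le_max_right _ _ : K ^ (1 / s) ≤ M) hs0.le
    rwa [← Real.rpow_mul hK.le, one_div_mul_cancel hs0.ne', Real.rpow_one] at h2
  refine ⟨Real.exp 1 * M, by positivity, ?_⟩
  intro ε m T F D P hε hε1 hm hT hsys hP hP'
  set Λ := ε ^ (-(p / s)) with hΛ
  have hΛ1 : 1 ≤ Λ := by
    refine Real.one_le_rpow_of_pos_of_le_one_of_nonpos hε hε1 ?_
    have : 0 < p / s := by positivity
    linarith
  have hτ₀ : τ₁ + 3 ≤ Real.log (M * Λ) := by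
    rw [Real.le_log_iff_exp_le (by positivity)]
    calc _ ≤ M := le_max_left _ _
      _ ≤ M * Λ := le_mul_of_one_le_right hM0.le hΛ1
  have hX : K ≤ ε ^ p * Real.exp (s * Real.log (M * Λ)) := by
    have h1 : ε ^ p * Λ ^ s = 1 := by
      rw [hΛ, ← Real.rpow_mul hε.le, ← Real.rpow_add hε,
        show p + -(p / s) * s = 0 by field_simp; ring, Real.rpow_zero]
    rw [mul_comm s, Real.exp_mul, Real.exp_log (by positivity),
      Real.mul_rpow hM0.le (by positivity)]
    calc K ≤ M ^ s * 1 := by rwa [mul_one]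
      _ = _ := by rw [← h1]; ring
  have hfin := hwave hm (Real.rpow_pos_of_pos hε p) hsys hP hP' _ hτ₀ hX
  have h3 := Real.exp_le_exp.2 hfin
  rw [Real.exp_add, Real.exp_log (by linarith), Real.exp_log (by positivity)] at h3
  linarith

theorem lifespan_le {n : ℕ} {μ₁ μ₂ p R : ℝ} {f g : Space n → ℝ} {ε X : ℝ}
    (h : ∀ T, 0 < T → ∀ u : ℝ → Lp ℝ 2 (volume : Measure (Space n)),
      IsEnergySolution n μ₁ μ₂ p ε f g T u → SupportedInCone R T u → T ≤ X) :
    lifespan n μ₁ μ₂ p R f g ε ≤ ENNReal.ofReal X := by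
  refine sSup_le ?_
  rintro _ ⟨T, hT, rfl, u, hu, hsupp⟩
  exact ENNReal.ofReal_le_ofReal (h T hT u hu hsupp)

end ScaleInvariantWave

/-! ### The three regimes -/

open ScaleInvariantWave
theorem theorem1p2 (n : ℕ) (hn : 1 ≤ n) (μ₁ μ₂ δ : ℝ) (hδ : δ = discr μ₁ μ₂) (hδ0 : 0 ≤ δ)
    (p : ℝ) (hp1 : 1 < p) (hp : (p : EReal) < blowupExponent n μ₁ δ)
    (f g h : Space n → ℝ) (hf : MemH1 f) (hg : MemLp g 2)
    (hh : ∀ x, h x = (μ₁ - 1 + Real.sqrt δ) / 2 * f x + g x)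
    (hf0 : ∀ᵐ x, 0 ≤ f x) (hh0 : ∀ᵐ x, 0 ≤ h x) (hhpos : ¬ ∀ᵐ x, h x = 0)
    (R : ℝ) (hR : 1 ≤ R) :
    ∃ φ : ℝ → ℝ,
      -- in the heat-like regime `φ(ε)` is the unique positive solution of its equation
      ((((n : ℝ) - 2 < Real.sqrt δ ∧ Real.sqrt δ < n - dStar (n + μ₁) ∧ p ≤ 2 / (n - Real.sqrt δ))
          ∨ n - dStar (n + μ₁) ≤ Real.sqrt δ) →
        ∀ ε : ℝ, 0 < ε →
          IsHeatScale n μ₁ δ p ε (φ ε) ∧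
          (∀ y : ℝ, IsHeatScale n μ₁ δ p ε y → y = φ ε) ∧
          (0 < δ →
            φ ε = ε ^ (-(p - 1) / gammaF p (n + (μ₁ - 1 - Real.sqrt δ) / 2)) ∧
            φ ε = ε ^ (-(2 / (p - 1) - n - (μ₁ - 1 - Real.sqrt δ) / 2)⁻¹))) ∧
      -- the lifespan estimates
      ∃ ε₂ : ℝ, 0 < ε₂ ∧ ∃ C : ℝ, 0 < C ∧ ∀ ε : ℝ, 0 < ε → ε ≤ ε₂ →
        (Real.sqrt δ ≤ (n : ℝ) - 2 →
          lifespan n μ₁ μ₂ p R f g ε ≤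
            ENNReal.ofReal (C * ε ^ (-(2 * p * (p - 1)) / gammaS p (n + μ₁)))) ∧
        ((n : ℝ) - 2 < Real.sqrt δ → Real.sqrt δ < n - dStar (n + μ₁) →
          (p ≤ 2 / (n - Real.sqrt δ) →
            lifespan n μ₁ μ₂ p R f g ε ≤ ENNReal.ofReal (C * φ ε)) ∧
          (2 / (n - Real.sqrt δ) < p →
            lifespan n μ₁ μ₂ p R f g ε ≤
              ENNReal.ofReal (C * ε ^ (-(2 * p * (p - 1)) / gammaS p (n + μ₁))))) ∧
        (n - dStar (n + μ₁) ≤ Real.sqrt δ →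
          lifespan n μ₁ μ₂ p R f g ε ≤ ENNReal.ofReal (C * φ ε)) := by
  have hp1' : 0 < p - 1 := by linarith
  have hmid (hlt : Real.sqrt δ < n - dStar (n + μ₁)) : 0 < n - Real.sqrt δ := by
    linarith [dStar_nonneg (n + μ₁)]
  have hγF₁ (hlt : Real.sqrt δ < n - dStar (n + μ₁)) (hle : p ≤ 2 / (n - Real.sqrt δ)) :
      0 < gammaF p (heatDim n μ₁ δ) :=
    gammaF_pos_of_mul_le hp1 hp fun _ => (le_div_iff₀ (hmid hlt)).1 hle
  -- Below the Strauss exponent p d_* ≤ 2, and here n - √δ ≤ d_*.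
  have hγF₂ (hle : n - dStar (n + μ₁) ≤ Real.sqrt δ) : 0 < gammaF p (heatDim n μ₁ δ) :=
    gammaF_pos_of_mul_le hp1 hp fun hS => by
      have h1 := mul_dStar_le_of_lt_straussExponent hS
      have h2 : p * (n - Real.sqrt δ) ≤ p * dStar (n + μ₁) := by gcongr; linarith
      linarith
  -- Here n - √δ ≥ 2 and p > 1.
  have hγS₁ (hle : Real.sqrt δ ≤ n - 2) : 0 < gammaS p (n + μ₁) :=
    gammaS_pos_of_le_mul hp1 hp (by nlinarith)
  have hγS₂ (hlt : Real.sqrt δ < n - dStar (n + μ₁)) (hle : 2 / (n - Real.sqrt δ) < p) :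
      0 < gammaS p (n + μ₁) :=
    gammaS_pos_of_le_mul hp1 hp ((div_lt_iff₀ (hmid hlt)).1 hle).le
  obtain ⟨φ, hφ⟩ := exists_isHeatScale n μ₁ hδ0 hp1
  obtain ⟨c, c', H, τ₁, hc, hc', hH, hτ₁, hsol⟩ := IsEnergySolution.exists_logSystem hn hδ hδ0 hp1
    hf.1 hg hh hf0 hh0 hhpos hR
  refine ⟨φ, ?_, 1, one_pos, ?_⟩
  · intro hcase ε hε
    have hγ : 0 < gammaF p (heatDim n μ₁ δ) := by
      rcases hcase with ⟨-, hlt, hle⟩ | hle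
      exacts [hγF₁ hlt hle, hγF₂ hle]
    have hφε := hφ hγ ε hε
    refine ⟨hφε, fun y hy => ?_, fun hδpos => ?_⟩
    · exact le_antisymm (hφε.le_of_le hδ0 hp1 hγ hy hε le_rfl)
        (hy.le_of_le hδ0 hp1 hγ hφε hε le_rfl)
    · have h1 := hφε.eq_rpow hp1 hδpos hγ
      refine ⟨h1, h1.trans ?_⟩
      congr 1
      have h2 : 2 / (p - 1) - n - (μ₁ - 1 - Real.sqrt δ) / 2
          = gammaF p (heatDim n μ₁ δ) / (p - 1) := by
        rw [gammaF, heatDim]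
        field_simp
        ring
      rw [h2, inv_div, neg_div]
  · have hheat : ∃ C : ℝ, 0 < C ∧ (0 < gammaF p (heatDim n μ₁ δ) → ∀ ε, 0 < ε → ε ≤ 1 →
        ∀ T, 0 < T → ∀ u : ℝ → Lp ℝ 2 (volume : Measure (Space n)),
        IsEnergySolution n μ₁ μ₂ p ε f g T u → SupportedInCone R T u → T ≤ C * φ ε) := by
      by_cases hγ : 0 < gammaF p (heatDim n μ₁ δ)
      · obtain ⟨C, hC, hle⟩ := LogSystem.exists_le_heatScale hδ0 hp1 hγ hc hH (hφ hγ)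
        refine ⟨C, hC, fun _ ε hε hε1 T hT u hu hsupp => ?_⟩
        obtain ⟨F, D, P, hsys, hP, -⟩ := hsol hε hT u hu hsupp
        exact hle hε hε1 hT hsys hP
      · exact ⟨1, one_pos, fun h => absurd h hγ⟩
    have hwave : ∃ C : ℝ, 0 < C ∧ (0 < gammaS p (n + μ₁) → ∀ ε, 0 < ε → ε ≤ 1 →
        ∀ T, 0 < T → ∀ u : ℝ → Lp ℝ 2 (volume : Measure (Space n)),
        IsEnergySolution n μ₁ μ₂ p ε f g T u → SupportedInCone R T u →
          T ≤ C * ε ^ (-(2 * p * (p - 1)) / gammaS p (n + μ₁))) := by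
      by_cases hγ : 0 < gammaS p (n + μ₁)
      · obtain ⟨C, hC, hle⟩ := LogSystem.exists_le_rpow (δ := δ) hp1 hγ hc hc' hτ₁
        refine ⟨C, hC, fun _ ε hε hε1 T hT u hu hsupp => ?_⟩
        obtain ⟨F, D, P, hsys, hP, hP'⟩ := hsol hε hT u hu hsupp
        exact hle hε hε1 (by positivity) hT hsys hP hP'
      · exact ⟨1, one_pos, fun h => absurd h hγ⟩
    obtain ⟨C₁, hC₁, hheat⟩ := hheat
    obtain ⟨C₂, hC₂, hwave⟩ := hwave
    refine ⟨max C₁ C₂, lt_max_of_lt_left hC₁, fun ε hε hε1 => ?_⟩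
    have hH' (hγ : 0 < gammaF p (heatDim n μ₁ δ)) :
        lifespan n μ₁ μ₂ p R f g ε ≤ ENNReal.ofReal (max C₁ C₂ * φ ε) :=
      lifespan_le fun T hT u hu hsupp => (hheat hγ ε hε hε1 T hT u hu hsupp).trans
        (mul_le_mul_of_nonneg_right (le_max_left _ _) (hφ hγ ε hε).1.le)
    have hW' (hγ : 0 < gammaS p (n + μ₁)) : lifespan n μ₁ μ₂ p R f g ε ≤
        ENNReal.ofReal (max C₁ C₂ * ε ^ (-(2 * p * (p - 1)) / gammaS p (n + μ₁))) :=
      lifespan_le fun T hT u hu hsupp => (hwave hγ ε hε hε1 T hT u hu hsupp).trans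
        (mul_le_mul_of_nonneg_right (le_max_right _ _) (Real.rpow_nonneg hε.le _))
    exact ⟨fun h1 => hW' (hγS₁ h1), fun _ hlt => ⟨fun hle => hH' (hγF₁ hlt hle),
      fun hle => hW' (hγS₂ hlt hle)⟩, fun hle => hH' (hγF₂ hle)⟩
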